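/- Let $W$ be the principal branch of the Lambert function (the inverse of $w\mapsto we^{w}$ on $[-1,\infty)$). Put $g(r)=e^{-r/\sqrt2}\bigl(\sin\tfrac{r}{\sqrt2}+\cos\tfrac{r}{\sqrt2}\bigr)$ and $\lambda_1(r)=\frac{1}{r^2}\bigl[W(e^{g(r)})-g(r)\bigr]^2$ for $r>0$. For an integer $k\ge 0$ let $r_k=\sqrt2\,(\tfrac{3\pi}{4}+k\pi)$ (a zero of $g$), and define the (continuous) potential $$V_k(r)=-\lambda_1(r)\ \text{ for } 0<r\le r_k,\qquad V_k(r)=-\frac{W(1)^2}{r^2}\ \text{ for } r>r_k .$$ Let $M,m>0$, $\gamma=\frac{2Mm}{2M+m}$ and $\varepsilon^2=\frac{2\gamma}{M}$. For an integer $l\ge 1$, a real number $E$ is called an eigenvalue of the radial problem if there is a real-valued $u\in C^2(0,\infty)\cap L^2(0,\infty)$ with $$-\varepsilon^2\Bigl(u''(r)-\frac{l(l+1)}{r^2}u(r)\Bigr)+V_k(r)u(r)=E\,u(r)\quad (r>0),\qquad \lim_{r\to0^+}u(r)=0,\qquad \lim_{r\to0^+}r^{-(l+1)}u(r)=1 .$$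 Then, for every $l\ge1$, $k\ge0$ and $M,m>0$, the radial problem has infinitely many eigenvalues if and only if $$\frac{M}{m}>\mathcal M_l^*:=\frac{4l(l+1)+1-W(1)^2}{2W(1)^2}.$$ -/

import Mathlib

open Set Filter Topology MeasureTheory

noncomputable section

namespace Efimov

/-- The principal real branch of the Lambert function: the inverse of `w ↦ w * exp w`,
restricted to `[-1, ∞)`. It is meaningful on `[-exp (-1), ∞)`. -/
def lambertW (x : ℝ) : ℝ :=
  Function.invFunOn (fun w : ℝ => w * Real.exp w) (Ici (-1)) x

theorem strictMonoOn_mul_exp :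
    StrictMonoOn (fun w : ℝ => w * Real.exp w) (Ici (-1)) := by
  apply strictMonoOn_of_deriv_pos (convex_Ici _) (by fun_prop)
  intro x hx
  rw [interior_Ici, mem_Ioi] at hx
  have h : HasDerivAt (fun w : ℝ => w * Real.exp w)
      (1 * Real.exp x + x * Real.exp x) x :=
    (hasDerivAt_id x).mul (Real.hasDerivAt_exp x)
  rw [h.deriv]
  have := Real.exp_pos x
  nlinarith

theorem exists_mul_exp_eq {x : ℝ} (hx : -Real.exp (-1) ≤ x) :
    ∃ w ∈ Ici (-1 : ℝ), w * Real.exp w = x := by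
  have hb : (-1 : ℝ) ≤ max x 0 := le_trans (by norm_num) (le_max_right _ _)
  have hc : ContinuousOn (fun w : ℝ => w * Real.exp w) (Icc (-1) (max x 0)) := by fun_prop
  have h0 : (0 : ℝ) ≤ max x 0 := le_max_right _ _
  have hx2 : x ≤ max x 0 * Real.exp (max x 0) :=
    le_trans (le_max_left x 0) (le_mul_of_one_le_right h0 (Real.one_le_exp h0))
  obtain ⟨w, hw, hwx⟩ := intermediate_value_Icc hb hc ⟨by simpa using hx, hx2⟩
  exact ⟨w, hw.1, hwx⟩

/-- On `[-exp (-1), ∞)` the value `lambertW x` lies in `[-1, ∞)` and solves `w * exp w = x`. -/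
theorem lambertW_spec {x : ℝ} (hx : -Real.exp (-1) ≤ x) :
    -1 ≤ lambertW x ∧ lambertW x * Real.exp (lambertW x) = x :=
  ⟨Function.invFunOn_mem (exists_mul_exp_eq hx), Function.invFunOn_eq (exists_mul_exp_eq hx)⟩

/-- `lambertW x` is the only solution of `w * exp w = x` in `[-1, ∞)`. -/
theorem lambertW_eq_of_mul_exp_eq {x w : ℝ} (hw : -1 ≤ w) (h : w * Real.exp w = x) :
    lambertW x = w := by
  have hex : ∃ v ∈ Ici (-1 : ℝ), v * Real.exp v = x := ⟨w, hw, h⟩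
  exact strictMonoOn_mul_exp.injOn (Function.invFunOn_mem hex) hw
    ((Function.invFunOn_eq hex).trans h.symm)

/-- `g(r) = exp (-r/√2) * (sin (r/√2) + cos (r/√2))`. -/
def g (r : ℝ) : ℝ :=
  Real.exp (-(r / √2)) * (Real.sin (r / √2) + Real.cos (r / √2))

/-- `λ₁(r) = (W(exp g(r)) - g(r))² / r²` for `r > 0`. (Its limit at `0` is `0`,
which is also its value there.) -/
def lambdaOne (r : ℝ) : ℝ :=
  1 / r ^ 2 * (lambertW (Real.exp (g r)) - g r) ^ 2

/-- The zeros `r_k = √2 (3π/4 + kπ)` of `g` on `(0, ∞)`, for `k = 0, 1, 2, …`. -/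
def rRoot (k : ℕ) : ℝ := √2 * (3 * Real.pi / 4 + k * Real.pi)

/-- The potential `V_k`. -/
def potential (k : ℕ) (r : ℝ) : ℝ :=
  if r ≤ rRoot k then -lambdaOne r else -(lambertW 1 ^ 2 / r ^ 2)

/-- The reduced mass `γ` of a light particle of mass `m` and a pair of heavy particles of
mass `M` each. -/
def reducedMass (M m : ℝ) : ℝ := 2 * M * m / (2 * M + m)

/-- The Born–Oppenheimer parameter `ε² = 2γ/M`. -/
def epsSq (M m : ℝ) : ℝ := 2 * reducedMass M m / M

/-- `E` is an eigenvalue of the radial problem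
`-ε² (u'' - l(l+1)/r² u) + V u = E u` on `(0, ∞)`, `u ∈ L²(0, ∞)`,
`u(r) → 0` and `r^{-(l+1)} u(r) → 1` as `r → 0+`.
Here `V` is meant to be continuous on `(0, ∞)`, so that solutions are of class `C²`. -/
def IsRadialEigenvalue (εsq : ℝ) (l : ℕ) (V : ℝ → ℝ) (E : ℝ) : Prop :=
  ∃ u : ℝ → ℝ,
    ContDiffOn ℝ 2 u (Ioi 0) ∧
    (∀ r : ℝ, 0 < r →
      -εsq * (deriv (deriv u) r - (l : ℝ) * (l + 1) / r ^ 2 * u r) + V r * u r = E * u r) ∧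
    MemLp u 2 (volume.restrict (Ioi 0)) ∧
    Tendsto u (𝓝[>] 0) (𝓝 0) ∧
    Tendsto (fun r : ℝ => u r / r ^ (l + 1)) (𝓝[>] 0) (𝓝 1)

/-- The critical mass ratio `(4l(l+1) + 1 - W(1)²) / (2 W(1)²)`. -/
def criticalMassRatio (l : ℕ) : ℝ :=
  (4 * (l : ℝ) * (l + 1) + 1 - lambertW 1 ^ 2) / (2 * lambertW 1 ^ 2)

end Efimov

end

noncomputable section

namespace Efimov

/-! Write c = W(1)² and e = ε². For r ≥ r_k the equation reads u'' = ((l(l+1) - c/e)/r² - E/e) u,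
and the mass condition says exactly that c/e > l(l+1) + 1/4 (`criticalMassRatio_lt_iff`). The
question is therefore whether the attractive inverse-square tail beats the Hardy constant 1/4. The
inner part of the potential matters only through its continuity up to r = 0
(`continuousOn_potential`).

At or below the threshold the eigenvalues are finite in number. A positive E is impossible: u'² +
(E/e)u² stays bounded away from 0, which is incompatible with u in L² (`IsSolution.not_memLp`). For
E < 0, Sturm comparison with a cosine on short intervals of (0, r_k) and with √r on the tail bounds
the number of zeros of a regular solution by some N independent of E (`exists_zero_count_bound`).
Sturm oscillation makes the number of zeros of an eigenfunction strictly increasing in E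
(`ncard_zeros_lt`), so there are at most N + 1 negative eigenvalues, besides possibly E = 0.

Above the threshold put ν² = c/e - l(l+1) - 1/4 > 0 and E = -eκ². The tail equation has the decaying
solution √r K_{iν}(κr), and E is an eigenvalue once this is proportional at r_k, with its
derivative, to the solution regular at 0. The regular solution comes from a Volterra equation and
depends continuously on E (`exists_regular_solution`), so its Cauchy data at r_k have a nonzero
limit as κ → 0. Meanwhile K_{iν} oscillates indefinitely in log κ (`exists_macdonald_asymptotics`).
Hence the matching condition has infinitely many roots (`exists_zero_macdonald_comb`), giving
infinitely many eigenvalues accumulating at 0. -/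

/-! ### Continuity of the potential, its tail, and the threshold -/

theorem lambertW_one_pos : 0 < lambertW 1 := by
  have h := (lambertW_spec (x := 1) (by have := Real.exp_pos (-1); linarith)).2
  by_contra! hn
  have := mul_nonpos_of_nonpos_of_nonneg hn (Real.exp_pos (lambertW 1)).le
  linarith

/-- The quantity `W(exp x) - x` in the definition of `lambdaOne`. -/
def lambertGap (x : ℝ) : ℝ := lambertW (Real.exp x) - x

/-- With w = W(eˣ), the relation w eʷ = eˣ gives w = e^(x - w). The gap is thus an inverse of y ↦
e⁻ʸ - y, and no derivative of W is needed. -/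
theorem exp_neg_lambertGap (x : ℝ) : Real.exp (-lambertGap x) - lambertGap x = x := by
  have h := (lambertW_spec (x := Real.exp x) (by
    have := Real.exp_pos (-1); have := Real.exp_pos x; linarith)).2
  set w := lambertW (Real.exp x) with hw
  have hg : lambertGap x = w - x := rfl
  have : Real.exp (-lambertGap x) = w := by
    rw [hg, neg_sub, Real.exp_sub, ← h, mul_div_assoc, div_self (Real.exp_pos w).ne', mul_one]
  rw [this, hg]; ring

/-- The map y ↦ e⁻ʸ - y decreases with slope at most -1, so its inverse is 1-Lipschitz. -/
theorem abs_lambertGap_sub_le (x y : ℝ) : |lambertGap x - lambertGap y| ≤ |x - y| := by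
  have hx := exp_neg_lambertGap x
  have hy := exp_neg_lambertGap y
  set a := lambertGap x
  set b := lambertGap y
  rcases le_total a b with h | h
  · have : Real.exp (-b) ≤ Real.exp (-a) := Real.exp_le_exp.2 (by linarith)
    rw [abs_of_nonpos (by linarith), abs_of_nonneg (by linarith)]; linarith
  · have : Real.exp (-a) ≤ Real.exp (-b) := Real.exp_le_exp.2 (by linarith)
    rw [abs_of_nonneg (by linarith), abs_of_nonpos (by linarith)]; linarith

theorem continuous_lambertGap : Continuous lambertGap := by
  refine (LipschitzWith.of_dist_le_mul (K := 1) fun x y => ?_).continuous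
  simpa [Real.dist_eq] using abs_lambertGap_sub_le x y

theorem lambertGap_one : lambertGap 1 = 0 := by
  rw [lambertGap, lambertW_eq_of_mul_exp_eq (w := 1) (by norm_num) (by ring)]; ring

theorem continuous_g : Continuous g := by unfold g; fun_prop

/-- The derivative of `g` at `x` is `-√2 exp (-x/√2) sin (x/√2)`, whence `g` is close to `1`
to second order at `0`. -/
theorem abs_g_sub_one_le {r : ℝ} (hr : 0 ≤ r) : |g r - 1| ≤ r ^ 2 := by
  have h2 : (0 : ℝ) < √2 := by positivity
  have h22 : √2 * √2 = 2 := Real.mul_self_sqrt (by norm_num)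
  have hd : ∀ x : ℝ, HasDerivAt g (-(2 / √2) * (Real.exp (-(x / √2)) * Real.sin (x / √2))) x := by
    intro x
    have h1 : HasDerivAt (fun x : ℝ => x / √2) (1 / √2) x := (hasDerivAt_id x).div_const _
    have h := h1.neg.exp.mul (h1.sin.add h1.cos)
    refine h.congr_deriv ?_
    simp only [Pi.add_apply, Pi.neg_apply]
    ring
  have hb : ∀ x ∈ Icc 0 r, ‖-(2 / √2) * (Real.exp (-(x / √2)) * Real.sin (x / √2))‖ ≤ r := by
    intro x hx
    have hx2 : 0 ≤ x / √2 := div_nonneg hx.1 h2.le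
    rw [norm_mul, norm_mul, Real.norm_eq_abs, Real.norm_eq_abs, Real.norm_eq_abs, abs_neg,
      abs_of_pos (by positivity), abs_of_pos (Real.exp_pos _)]
    have he : Real.exp (-(x / √2)) ≤ 1 := Real.exp_le_one_iff.2 (by linarith)
    have hs : |Real.sin (x / √2)| ≤ x / √2 := by
      simpa [abs_of_nonneg hx2] using Real.abs_sin_le_abs (x := x / √2)
    calc 2 / √2 * (Real.exp (-(x / √2)) * |Real.sin (x / √2)|)
        ≤ 2 / √2 * (1 * (x / √2)) := by gcongr
      _ = 2 * x / (√2 * √2) := by field_simp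
      _ = x := by rw [h22]; ring
      _ ≤ r := hx.2
  have h := (convex_Icc 0 r).norm_image_sub_le_of_norm_hasDerivWithin_le
    (fun x _ => (hd x).hasDerivWithinAt) hb (left_mem_Icc.2 hr) (right_mem_Icc.2 hr)
  have hg0 : g 0 = 1 := by simp [g]
  rw [hg0, sub_zero, Real.norm_eq_abs, Real.norm_eq_abs, abs_of_nonneg hr] at h
  nlinarith

theorem lambdaOne_eq (r : ℝ) : lambdaOne r = 1 / r ^ 2 * lambertGap (g r) ^ 2 := rfl

theorem lambdaOne_le {r : ℝ} (hr : 0 ≤ r) : lambdaOne r ≤ r ^ 2 := by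
  rcases hr.eq_or_lt with rfl | hr'
  · simp [lambdaOne]
  have h : |lambertGap (g r)| ≤ r ^ 2 := by
    have := abs_lambertGap_sub_le (g r) 1
    rw [lambertGap_one, sub_zero] at this
    exact this.trans (abs_g_sub_one_le hr)
  rw [lambdaOne_eq, one_div, inv_mul_le_iff₀ (by positivity), ← sq_abs]
  calc |lambertGap (g r)| ^ 2 ≤ (r ^ 2) ^ 2 := by gcongr
    _ = _ := by ring

theorem lambdaOne_nonneg (r : ℝ) : 0 ≤ lambdaOne r := by
  rw [lambdaOne_eq]; positivity

theorem continuousOn_lambdaOne : ContinuousOn lambdaOne (Ici 0) := by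
  intro r hr
  rcases (show (0 : ℝ) ≤ r from hr).eq_or_lt with rfl | hr'
  · have h0 : lambdaOne 0 = 0 := by simp [lambdaOne]
    rw [ContinuousWithinAt, h0]
    refine tendsto_of_tendsto_of_tendsto_of_le_of_le' tendsto_const_nhds
      (h := fun r : ℝ => r ^ 2) ?_ (Eventually.of_forall lambdaOne_nonneg) ?_
    · have : Tendsto (fun r : ℝ => r ^ 2) (𝓝 0) (𝓝 0) := by
        simpa using (continuous_pow 2).tendsto (0 : ℝ)
      exact this.mono_left nhdsWithin_le_nhds
    · filter_upwards [self_mem_nhdsWithin] with r hr using lambdaOne_le hr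
  · refine ContinuousAt.continuousWithinAt ?_
    have : ContinuousAt (fun r => 1 / r ^ 2 * lambertGap (g r) ^ 2) r :=
      (continuousAt_const.div (by fun_prop) (by positivity)).mul
        ((continuous_lambertGap.comp continuous_g).continuousAt.pow 2)
    exact this

theorem rRoot_pos (k : ℕ) : 0 < rRoot k := by
  unfold rRoot; have := Real.pi_pos; positivity

theorem g_rRoot (k : ℕ) : g (rRoot k) = 0 := by
  have h2 : √2 ≠ 0 := by positivity
  have : rRoot k / √2 = 3 * Real.pi / 4 + k * Real.pi := by unfold rRoot; field_simp
  have h3 : 3 * Real.pi / 4 = Real.pi - Real.pi / 4 := by ring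
  rw [g, this, Real.sin_add_nat_mul_pi, Real.cos_add_nat_mul_pi, h3, Real.sin_pi_sub,
    Real.cos_pi_sub, Real.sin_pi_div_four, Real.cos_pi_div_four]
  ring

theorem potential_of_le {k : ℕ} {r : ℝ} (hr : rRoot k ≤ r) :
    potential k r = -(lambertW 1 ^ 2 / r ^ 2) := by
  -- At r_k itself the inner formula applies; g vanishes there, the gap becomes W(1), and the two
  -- branches agree.
  rcases hr.eq_or_lt with rfl | h
  · simp [potential, lambdaOne, g_rRoot]
    ring
  · simp [potential, not_le.2 h]

theorem continuousOn_potential (k : ℕ) : ContinuousOn (potential k) (Ici 0) := by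
  have hR := rRoot_pos k
  have h1 : ContinuousOn (potential k) (Icc 0 (rRoot k)) := by
    refine (continuousOn_lambdaOne.mono Icc_subset_Ici_self).neg.congr fun r hr => ?_
    simp [potential, hr.2]
  have h2 : ContinuousOn (potential k) (Ici (rRoot k)) := by
    have : ContinuousOn (fun r : ℝ => -(lambertW 1 ^ 2 / r ^ 2)) (Ici (rRoot k)) := by
      refine (continuousOn_const.div (by fun_prop) fun r hr => ?_).neg
      have : 0 < r := hR.trans_le hr
      positivity
    exact this.congr fun r hr => potential_of_le hr
  have := h1.union_of_isClosed h2 isClosed_Icc isClosed_Ici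
  rwa [Icc_union_Ici_eq_Ici hR.le] at this

theorem epsSq_pos {M m : ℝ} (hM : 0 < M) (hm : 0 < m) : 0 < epsSq M m := by
  unfold epsSq reducedMass; positivity

/-- Since ε² = 4m/(2M + m), the quotient W(1)²/ε² equals W(1)²(2M/m + 1)/4, an increasing affine
function of M/m. -/
theorem criticalMassRatio_lt_iff (l : ℕ) {M m : ℝ} (hM : 0 < M) (hm : 0 < m) :
    criticalMassRatio l < M / m ↔ (l : ℝ) * (l + 1) + 1 / 4 < lambertW 1 ^ 2 / epsSq M m := by
  have hW := lambertW_one_pos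
  have he : epsSq M m = 4 * m / (2 * M + m) := by
    unfold epsSq reducedMass; field_simp; ring
  rw [he, criticalMassRatio, div_lt_div_iff₀ (by positivity) hm, div_div_eq_mul_div,
    lt_div_iff₀ (by positivity)]
  constructor <;> intro h <;> linarith

/-! ### The radial equation as a first-order system; backward uniqueness -/

/-- The pair `(u, u')` solves `u'' = p u` on `s`. -/
def IsSolution (p u u' : ℝ → ℝ) (s : Set ℝ) : Prop :=
  ∀ r ∈ s, HasDerivAt u (u' r) r ∧ HasDerivAt u' (p r * u r) r

/-- The coefficient `p` for which the radial equation reads `u'' = p u`. -/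
def radialCoeff (e : ℝ) (l : ℕ) (V : ℝ → ℝ) (E r : ℝ) : ℝ :=
  (l : ℝ) * (l + 1) / r ^ 2 + (V r - E) / e

theorem IsSolution.mono {p u u' : ℝ → ℝ} {s t : Set ℝ} (h : IsSolution p u u' t) (hst : s ⊆ t) :
    IsSolution p u u' s := fun r hr => h r (hst hr)

theorem continuousOn_radialCoeff (e : ℝ) (l : ℕ) {V : ℝ → ℝ} (hV : ContinuousOn V (Ioi 0))
    (E : ℝ) : ContinuousOn (radialCoeff e l V E) (Ioi 0) := by
  unfold radialCoeff
  refine ContinuousOn.add (continuousOn_const.div (by fun_prop) fun r hr => ?_)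
    ((hV.sub continuousOn_const).div_const _)
  have : (0 : ℝ) < r := hr
  positivity

theorem IsRadialEigenvalue.exists_isSolution {e : ℝ} (he : e ≠ 0) {l : ℕ} {V : ℝ → ℝ} {E : ℝ}
    (h : IsRadialEigenvalue e l V E) :
    ∃ u u' : ℝ → ℝ, IsSolution (radialCoeff e l V E) u u' (Ioi 0) ∧
      MemLp u 2 (volume.restrict (Ioi 0)) ∧
      Tendsto u (𝓝[>] 0) (𝓝 0) ∧ Tendsto (fun r : ℝ => u r / r ^ (l + 1)) (𝓝[>] 0) (𝓝 1) := by
  obtain ⟨u, hu, heq, hL, h0, h1⟩ := h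
  refine ⟨u, deriv u, fun r hr => ?_, hL, h0, h1⟩
  have hd := (contDiffOn_succ_iff_deriv_of_isOpen (n := 1) isOpen_Ioi).1 (by rwa [one_add_one_eq_two])
  have hd2 := hd.2.2.differentiableOn (by norm_num)
  have hn : Ioi (0 : ℝ) ∈ 𝓝 r := isOpen_Ioi.mem_nhds hr
  refine ⟨((hd.1 r hr).differentiableAt hn).hasDerivAt, ?_⟩
  have h2 := ((hd2 r hr).differentiableAt hn).hasDerivAt
  refine h2.congr_deriv ?_
  have := heq r hr
  have hr0 : r ≠ 0 := ne_of_gt hr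
  unfold radialCoeff
  field_simp at this ⊢
  linarith

theorem isRadialEigenvalue_of_isSolution {e : ℝ} (he : e ≠ 0) {l : ℕ} {V : ℝ → ℝ}
    (hV : ContinuousOn V (Ioi 0)) {E : ℝ} {u u' : ℝ → ℝ}
    (hu : IsSolution (radialCoeff e l V E) u u' (Ioi 0))
    (hL : MemLp u 2 (volume.restrict (Ioi 0))) (h0 : Tendsto u (𝓝[>] 0) (𝓝 0))
    (h1 : Tendsto (fun r : ℝ => u r / r ^ (l + 1)) (𝓝[>] 0) (𝓝 1)) :
    IsRadialEigenvalue e l V E := by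
  have hd : ∀ r ∈ Ioi (0 : ℝ), deriv u r = u' r := fun r hr => (hu r hr).1.deriv
  have hd2 : ∀ r ∈ Ioi (0 : ℝ), HasDerivAt (deriv u) (radialCoeff e l V E r * u r) r := by
    intro r hr
    refine (hu r hr).2.congr_of_eventuallyEq ?_
    filter_upwards [isOpen_Ioi.mem_nhds hr] with x hx using hd x hx
  refine ⟨u, ?_, fun r hr => ?_, hL, h0, h1⟩
  · rw [show (2 : WithTop ℕ∞) = 1 + 1 from one_add_one_eq_two.symm,
      contDiffOn_succ_iff_deriv_of_isOpen isOpen_Ioi]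
    refine ⟨fun r hr => (hu r hr).1.differentiableAt.differentiableWithinAt, by simp, ?_⟩
    rw [show (1 : WithTop ℕ∞) = 0 + 1 from (zero_add 1).symm,
      contDiffOn_succ_iff_deriv_of_isOpen isOpen_Ioi]
    refine ⟨fun r hr => (hd2 r hr).differentiableAt.differentiableWithinAt, by simp, ?_⟩
    rw [contDiffOn_zero]
    refine ContinuousOn.congr ?_ fun r hr => (hd2 r hr).deriv
    exact (continuousOn_radialCoeff e l hV E).mul
      fun r hr => (hu r hr).1.continuousAt.continuousWithinAt
  · rw [(hd2 r hr).deriv, radialCoeff]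
    field_simp
    ring

/-- Backward uniqueness: a solution with vanishing Cauchy data at `c` vanishes on `(0, c]`. -/
theorem IsSolution.eq_zero_of_le {p u u' : ℝ → ℝ} {c : ℝ} (hu : IsSolution p u u' (Ioc 0 c))
    (hp : ContinuousOn p (Ioi 0)) (h0 : u c = 0) (h1 : u' c = 0) {x : ℝ} (hx : x ∈ Ioc 0 c) :
    u x = 0 := by
  have hsub : Icc x c ⊆ Ioc 0 c := fun y hy => ⟨hx.1.trans_le hy.1, hy.2⟩
  obtain ⟨P, hP⟩ := isCompact_Icc.exists_bound_of_continuousOn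
    (hp.mono fun y (hy : y ∈ Icc x c) => hx.1.trans_le hy.1)
  -- Gronwall by integrating factor: |(u² + u'²)'| = 2|1 + p||u u'| ≤ (1 + P)(u² + u'²), so the
  -- product with e^((1+P)y) increases and is 0 at c.
  have hd : ∀ y ∈ Icc x c, HasDerivAt (fun y => Real.exp ((1 + P) * y) * (u y ^ 2 + u' y ^ 2))
      (Real.exp ((1 + P) * y) * ((1 + P) * (u y ^ 2 + u' y ^ 2)
        + 2 * (1 + p y) * (u y * u' y))) y := by
    intro y hy
    obtain ⟨a, b⟩ := hu y (hsub hy)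
    have he : HasDerivAt (fun y => Real.exp ((1 + P) * y)) (Real.exp ((1 + P) * y) * (1 + P)) y := by
      simpa using ((hasDerivAt_id y).const_mul (1 + P)).exp
    refine (he.mul ((a.pow 2).add (b.pow 2))).congr_deriv ?_
    simp only [Pi.add_apply, Pi.pow_apply]
    push_cast
    ring
  have hm : MonotoneOn (fun y => Real.exp ((1 + P) * y) * (u y ^ 2 + u' y ^ 2)) (Icc x c) := by
    refine monotoneOn_of_hasDerivWithinAt_nonneg (convex_Icc x c)
      (fun y hy => (hd y hy).continuousAt.continuousWithinAt)
      (fun y hy => (hd y (interior_subset hy)).hasDerivWithinAt) fun y hy => ?_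
    have hPy := hP y (interior_subset hy)
    rw [Real.norm_eq_abs] at hPy
    have h2 : |2 * (1 + p y) * (u y * u' y)| ≤ (1 + P) * (u y ^ 2 + u' y ^ 2) := by
      have e1 : |1 + p y| ≤ 1 + P := (abs_add_le _ _).trans (by simpa using hPy)
      have e2 : 2 * |u y * u' y| ≤ u y ^ 2 + u' y ^ 2 := by
        rw [abs_mul, ← sq_abs (u y), ← sq_abs (u' y)]
        nlinarith [sq_nonneg (|u y| - |u' y|)]
      calc |2 * (1 + p y) * (u y * u' y)| = |1 + p y| * (2 * |u y * u' y|) := by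
            rw [abs_mul, abs_mul, abs_two]; ring
        _ ≤ _ := mul_le_mul e1 e2 (by positivity) ((abs_nonneg _).trans e1)
    exact mul_nonneg (Real.exp_pos _).le (by linarith [(abs_le.1 h2).1])
  have h := hm (left_mem_Icc.2 hx.2) (right_mem_Icc.2 hx.2) hx.2
  simp only [h0, h1] at h
  have h3 : u x ^ 2 + u' x ^ 2 ≤ 0 := by
    by_contra! hn
    have := mul_pos (Real.exp_pos ((1 + P) * x)) hn
    norm_num at h
    linarith
  have := sq_nonneg (u' x)
  exact pow_eq_zero_iff two_ne_zero |>.1 (le_antisymm (by linarith) (sq_nonneg _))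

/-- A solution with the regular behaviour `r ^ (l + 1)` at `0` has nonzero Cauchy data. -/
theorem IsSolution.cauchyData_ne_zero {p u u' : ℝ → ℝ} {c : ℝ} (hc : 0 < c)
    (hu : IsSolution p u u' (Ioc 0 c)) (hp : ContinuousOn p (Ioi 0)) {l : ℕ}
    (h1 : Tendsto (fun r : ℝ => u r / r ^ (l + 1)) (𝓝[>] 0) (𝓝 1)) : u c ≠ 0 ∨ u' c ≠ 0 := by
  by_contra! h
  have h2 : Tendsto (fun r : ℝ => u r / r ^ (l + 1)) (𝓝[>] 0) (𝓝 0) := by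
    refine tendsto_const_nhds.congr' ?_
    filter_upwards [Ioc_mem_nhdsGT hc] with r hr
    rw [hu.eq_zero_of_le hp h.1 h.2 hr, zero_div]
  exact one_ne_zero (tendsto_nhds_unique h1 h2)

/-! ### Growth and decay of solutions at infinity -/

theorem not_memLp_of_le_sq {u : ℝ → ℝ} {a δ : ℝ} (hδ : 0 < δ) (h : ∀ r, a ≤ r → δ ≤ u r ^ 2) :
    ¬ MemLp u 2 (volume.restrict (Ioi a)) := by
  intro hL
  have hi : Integrable (fun _ : ℝ => δ) (volume.restrict (Ioi a)) := by
    refine hL.integrable_sq.mono' (by fun_prop) ?_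
    filter_upwards [ae_restrict_mem measurableSet_Ioi] with r hr
    rw [Real.norm_eq_abs, abs_of_pos hδ]
    exact h r (le_of_lt hr)
  rcases integrable_const_iff.1 hi with h0 | h0
  · exact hδ.ne' h0
  · have := h0.measure_univ_lt_top
    simp at this

/-- Here (u²)' = 2uu' ≥ 2δ, so u² grows at least linearly. -/
theorem not_memLp_of_le_mul_deriv {u u' : ℝ → ℝ} {a δ : ℝ} (hδ : 0 < δ)
    (hu : ∀ r, a ≤ r → HasDerivAt u (u' r) r) (h : ∀ r, a ≤ r → δ ≤ u r * u' r) :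
    ¬ MemLp u 2 (volume.restrict (Ioi a)) := by
  intro hL
  have hm : MonotoneOn (fun r => u r ^ 2 - 2 * δ * r) (Ici a) := by
    have hd : ∀ r ∈ Ici a, HasDerivAt (fun r => u r ^ 2 - 2 * δ * r)
        (2 * (u r * u' r) - 2 * δ) r := by
      intro r hr
      refine (((hu r hr).pow 2).sub ((hasDerivAt_id r).const_mul (2 * δ))).congr_deriv ?_
      push_cast
      ring
    refine monotoneOn_of_hasDerivWithinAt_nonneg (convex_Ici a)
      (fun y hy => (hd y hy).continuousAt.continuousWithinAt)
      (fun y hy => (hd y (interior_subset hy)).hasDerivWithinAt) fun y hy => ?_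
    have := h y (interior_subset hy)
    linarith
  refine not_memLp_of_le_sq (u := u) (a := a + 1) (δ := 2 * δ) (by positivity) (fun r hr => ?_)
    (hL.mono_measure (Measure.restrict_mono (Ioi_subset_Ioi (by linarith)) le_rfl))
  have h1 := hm (self_mem_Ici) (show a ≤ r by linarith) (by linarith)
  simp only at h1
  nlinarith [sq_nonneg (u a)]

theorem IsSolution.hasDerivAt_mul {p u u' : ℝ → ℝ} {s : Set ℝ} (hu : IsSolution p u u' s) {r : ℝ}
    (hr : r ∈ s) : HasDerivAt (fun r => u r * u' r) (u' r ^ 2 + p r * u r ^ 2) r := by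
  obtain ⟨h1, h2⟩ := hu r hr
  exact (h1.mul h2).congr_deriv (by ring)

/-- If `p` is within `O(r⁻²)` of `-E < 0`, then nonzero solutions are not square integrable. -/
theorem IsSolution.not_memLp {p u u' : ℝ → ℝ} {R E C : ℝ} (hR : 0 < R) (hE : 0 < E)
    (hu : IsSolution p u u' (Ici R)) (hp : ∀ r, R ≤ r → |p r + E| ≤ C / r ^ 2)
    (h0 : u R ≠ 0 ∨ u' R ≠ 0) : ¬ MemLp u 2 (volume.restrict (Ioi R)) := by
  intro hL
  -- K is chosen so that 2|u u'| ≤ u² + u'² ≤ K Q.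
  set K := 1 + 1 / E with hK
  have hKpos : 0 < K := by positivity
  set Q : ℝ → ℝ := fun r => u' r ^ 2 + E * u r ^ 2 with hQ
  have hC : 0 ≤ C := by
    have := (abs_nonneg _).trans (hp R le_rfl)
    by_contra! hn
    exact absurd this (not_le.2 (div_neg_of_neg_of_pos hn (by positivity)))
  have hQ0 : ∀ r, 0 ≤ Q r := fun r => by positivity
  have hQR : 0 < Q R := by
    rcases h0 with h | h
    · have : 0 < u R ^ 2 := by positivity
      exact add_pos_of_nonneg_of_pos (sq_nonneg _) (by positivity)
    · have : 0 < u' R ^ 2 := by positivity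
      exact add_pos_of_pos_of_nonneg this (by positivity)
  -- Q' = 2(p + E)uu' is at most (C/r²)KQ in absolute value. The rate CK/r² is integrable at
  -- infinity, so the integrating factor stays bounded and Q cannot decay to 0.
  have hmon : MonotoneOn (fun r => Real.exp (-(C * K) / r) * Q r) (Ici R) := by
    have hd : ∀ r ∈ Ici R, HasDerivAt (fun r => Real.exp (-(C * K) / r) * Q r)
        (Real.exp (-(C * K) / r) * (C / r ^ 2 * (K * Q r) + (p r + E) * (2 * (u r * u' r)))) r := by
      intro r hr
      have hr0 : r ≠ 0 := (hR.trans_le hr).ne'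
      obtain ⟨h1, h2⟩ := hu r hr
      have he := ((hasDerivAt_const r (-(C * K))).div (hasDerivAt_id r) hr0).exp
      refine (he.mul ((h2.pow 2).add ((h1.pow 2).const_mul E))).congr_deriv ?_
      simp only [Pi.add_apply, Pi.pow_apply, Pi.div_apply, id, hQ]
      push_cast
      ring
    refine monotoneOn_of_hasDerivWithinAt_nonneg (convex_Ici R)
      (fun y hy => (hd y hy).continuousAt.continuousWithinAt)
      (fun y hy => (hd y (interior_subset hy)).hasDerivWithinAt) fun y hy => ?_
    have hy' : R ≤ y := interior_subset hy
    have e2 : |2 * (u y * u' y)| ≤ K * Q y := by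
      have e3 : K * Q y = u y ^ 2 + u' y ^ 2 + (E * u y ^ 2 + u' y ^ 2 / E) := by
        rw [hK, hQ]; field_simp; ring
      have e4 : 0 ≤ E * u y ^ 2 + u' y ^ 2 / E := by positivity
      rw [e3]
      refine abs_le.2 ⟨?_, ?_⟩ <;> nlinarith [sq_nonneg (u y + u' y), sq_nonneg (u y - u' y)]
    have e5 : |(p y + E) * (2 * (u y * u' y))| ≤ C / y ^ 2 * (K * Q y) := by
      rw [abs_mul]
      exact mul_le_mul (hp y hy') e2 (abs_nonneg _) (by positivity)
    exact mul_nonneg (Real.exp_pos _).le (by linarith [(abs_le.1 e5).1])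
  set c := Real.exp (-(C * K) / R) * Q R with hc
  have hcpos : 0 < c := mul_pos (Real.exp_pos _) hQR
  have hQc : ∀ r, R ≤ r → c ≤ Q r := by
    intro r hr
    have hr0 : 0 < r := hR.trans_le hr
    refine (hmon self_mem_Ici hr hr).trans (mul_le_of_le_one_left (hQ0 r) ?_)
    rw [Real.exp_le_one_iff, neg_div]
    have : 0 ≤ C * K / r := by positivity
    linarith
  -- With p ≥ -E - C/R², this B gives (uu')' = u'² + p u² ≥ Q - B u² ≥ c - B u². As u² is
  -- integrable, uu' then grows linearly.
  set B := 2 * E + C / R ^ 2 with hB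
  have hBpos : 0 < B := by positivity
  have hcont : ContinuousOn (fun r => u r ^ 2) (Ici R) :=
    fun r hr => ((hu r hr).1.continuousAt.pow 2).continuousWithinAt
  have hint : IntegrableOn (fun r => u r ^ 2) (Ioi R) := hL.integrable_sq
  set I := ∫ r in Ioi R, u r ^ 2 with hI
  have hlow : ∀ r, R ≤ r → u R * u' R + c * (r - R) - B * I ≤ u r * u' r := by
    intro r hr
    have hii : IntervalIntegrable (fun r => u r ^ 2) volume R r :=
      (hcont.mono (by rw [uIcc_of_le hr]; exact Icc_subset_Ici_self)).intervalIntegrable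
    have hs : ∫ x in R..r, u x ^ 2 ≤ I := by
      rw [intervalIntegral.integral_of_le hr]
      exact setIntegral_mono_set hint (Eventually.of_forall fun x => sq_nonneg _)
        (Eventually.of_forall fun x (hx : x ∈ Ioc R r) => hx.1)
    have h1 : ∫ x in R..r, (c - B * u x ^ 2) ≤ u r * u' r - u R * u' R := by
      refine intervalIntegral.integral_le_sub_of_hasDeriv_right_of_le hr
        (fun x hx => (hu.hasDerivAt_mul (show x ∈ Ici R from hx.1)).continuousAt.continuousWithinAt)
        (fun x hx => (hu.hasDerivAt_mul (show x ∈ Ici R from hx.1.le)).hasDerivWithinAt)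
        ?_ fun x hx => ?_
      · refine ContinuousOn.integrableOn_Icc ?_
        exact continuousOn_const.sub (continuousOn_const.mul (hcont.mono Icc_subset_Ici_self))
      · have hq := hQc x hx.1.le
        have hp1 := (abs_le.1 (hp x hx.1.le)).1
        have hp2 : C / x ^ 2 ≤ C / R ^ 2 := by gcongr; exact hx.1.le
        have : (-B + E) * u x ^ 2 ≤ p x * u x ^ 2 :=
          mul_le_mul_of_nonneg_right (by linarith) (sq_nonneg _)
        simp only [hQ] at hq
        linarith
    rw [intervalIntegral.integral_sub (by simp) (hii.const_mul B),
      intervalIntegral.integral_const, intervalIntegral.integral_const_mul, smul_eq_mul] at h1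
    nlinarith
  set a := max R (R + (B * I - u R * u' R + 1) / c) with ha
  have haR : R ≤ a := le_max_left _ _
  refine not_memLp_of_le_mul_deriv (u := u) (u' := u') (a := a) one_pos
    (fun r hr => (hu r (haR.trans hr)).1) (fun r hr => ?_)
    (hL.mono_measure (Measure.restrict_mono (Ioi_subset_Ioi haR) le_rfl))
  have h1 := hlow r (haR.trans hr)
  have h2 : (B * I - u R * u' R + 1) / c ≤ r - R := by
    have : R + (B * I - u R * u' R + 1) / c ≤ r := (le_max_right _ _).trans hr
    linarith
  rw [div_le_iff₀ hcpos] at h2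
  linarith

/-- If `p ≥ 0` near infinity, then square integrable solutions tend to `0` and have bounded
derivatives. -/
theorem IsSolution.tendsto_zero {p u u' : ℝ → ℝ} {R : ℝ} (hu : IsSolution p u u' (Ici R))
    (hp : ∀ r, R ≤ r → 0 ≤ p r) (hL : MemLp u 2 (volume.restrict (Ioi R))) :
    Tendsto u atTop (𝓝 0) ∧ ∃ C, ∀ r, R ≤ r → |u' r| ≤ C := by
  -- (uu')' = u'² + p u² ≥ 0, so one positive value of uu' would persist and force u² to grow. Hence
  -- uu' ≤ 0, and both u² and u'² are nonincreasing.
  have hf : MonotoneOn (fun r => u r * u' r) (Ici R) := by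
    refine monotoneOn_of_hasDerivWithinAt_nonneg (convex_Ici R)
      (fun y hy => (hu.hasDerivAt_mul hy).continuousAt.continuousWithinAt)
      (fun y hy => (hu.hasDerivAt_mul (interior_subset hy)).hasDerivWithinAt) fun y hy => ?_
    have := hp y (interior_subset hy)
    positivity
  have hneg : ∀ r, R ≤ r → u r * u' r ≤ 0 := by
    intro r hr
    by_contra! h
    exact not_memLp_of_le_mul_deriv (u := u) (u' := u') (a := r) h
      (fun x hx => (hu x (hr.trans hx)).1) (fun x hx => hf hr (hr.trans hx) hx)
      (hL.mono_measure (Measure.restrict_mono (Ioi_subset_Ioi hr) le_rfl))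
  have hd1 : ∀ r ∈ Ici R, HasDerivAt (fun r => u r ^ 2) (2 * (u r * u' r)) r := fun r hr =>
    ((hu r hr).1.pow 2).congr_deriv (by push_cast; ring)
  have hd2 : ∀ r ∈ Ici R, HasDerivAt (fun r => u' r ^ 2) (2 * (p r * (u r * u' r))) r :=
    fun r hr => ((hu r hr).2.pow 2).congr_deriv (by push_cast; ring)
  have ha1 : AntitoneOn (fun r => u r ^ 2) (Ici R) := by
    refine antitoneOn_of_hasDerivWithinAt_nonpos (convex_Ici R)
      (fun y hy => (hd1 y hy).continuousAt.continuousWithinAt)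
      (fun y hy => (hd1 y (interior_subset hy)).hasDerivWithinAt) fun y hy => ?_
    linarith [hneg y (interior_subset hy)]
  have ha2 : AntitoneOn (fun r => u' r ^ 2) (Ici R) := by
    refine antitoneOn_of_hasDerivWithinAt_nonpos (convex_Ici R)
      (fun y hy => (hd2 y hy).continuousAt.continuousWithinAt)
      (fun y hy => (hd2 y (interior_subset hy)).hasDerivWithinAt) fun y hy => ?_
    have := mul_nonpos_of_nonneg_of_nonpos (hp y (interior_subset hy)) (hneg y (interior_subset hy))
    linarith
  refine ⟨?_, |u' R|, fun r hr => sq_le_sq.1 (ha2 self_mem_Ici hr hr)⟩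
  rw [Metric.tendsto_atTop]
  intro ε hε
  obtain ⟨N, hN, hlt⟩ : ∃ N, R ≤ N ∧ u N ^ 2 < ε ^ 2 := by
    by_contra! h
    exact not_memLp_of_le_sq (u := u) (a := R) (δ := ε ^ 2) (by positivity) h hL
  refine ⟨N, fun r hr => ?_⟩
  rw [Real.dist_eq, sub_zero]
  have := (ha1 hN (hN.trans hr) hr).trans_lt hlt
  rw [sq_lt_sq, abs_of_pos hε] at this
  exact this

/-! ### Wronskians, Sturm comparison and interlacing of zeros -/

/-- The Wronskian `u v' - u' v`. -/
def wronskian (u u' v v' : ℝ → ℝ) (r : ℝ) : ℝ := u r * v' r - u' r * v r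

theorem IsSolution.const_mul {p u u' : ℝ → ℝ} {s : Set ℝ} (hu : IsSolution p u u' s) (c : ℝ) :
    IsSolution p (fun r => c * u r) (fun r => c * u' r) s := fun r hr =>
  ⟨(hu r hr).1.const_mul c, ((hu r hr).2.const_mul c).congr_deriv (by ring)⟩

theorem IsSolution.hasDerivAt_wronskian {p q u u' v v' : ℝ → ℝ} {s : Set ℝ}
    (hu : IsSolution p u u' s) (hv : IsSolution q v v' s) {r : ℝ} (hr : r ∈ s) :
    HasDerivAt (wronskian u u' v v') ((q r - p r) * (u r * v r)) r :=
  (((hu r hr).1.mul (hv r hr).2).sub ((hu r hr).2.mul (hv r hr).1)).congr_deriv (by ring)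

/-- If `q < p` then a positive solution of `u'' = p u` and a positive solution of `v'' = q v`
cannot have a Wronskian with limit `≤ 0` on the left and `≥ 0` on the right. -/
theorem false_of_wronskian_limits {p q u u' v v' : ℝ → ℝ} {S : Set ℝ}
    (hc : Convex ℝ S) (hne : S.Nonempty) (hu : IsSolution p u u' S) (hv : IsSolution q v v' S)
    (hpq : ∀ r ∈ S, q r < p r) (hu0 : ∀ r ∈ S, 0 < u r) (hv0 : ∀ r ∈ S, 0 < v r)
    {la lb : Filter ℝ} [la.NeBot] [lb.NeBot] (hla : ∀ r ∈ S, ∀ᶠ x in la, x ∈ S ∧ x < r)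
    (hlb : ∀ r ∈ S, ∀ᶠ x in lb, x ∈ S ∧ r < x) {A B : ℝ} (hA : A ≤ 0) (hB : 0 ≤ B)
    (hWa : Tendsto (wronskian u u' v v') la (𝓝 A)) (hWb : Tendsto (wronskian u u' v v') lb (𝓝 B)) :
    False := by
  -- The Wronskian has derivative (q - p)uv < 0, so it cannot go from a limit ≤ 0 to a limit ≥ 0.
  have hanti : StrictAntiOn (wronskian u u' v v') S := by
    refine strictAntiOn_of_hasDerivWithinAt_neg hc
      (fun y hy => (hu.hasDerivAt_wronskian hv hy).continuousAt.continuousWithinAt)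
      (fun y hy => (hu.hasDerivAt_wronskian hv (interior_subset hy)).hasDerivWithinAt)
      fun y hy => ?_
    have hy' := interior_subset hy
    exact mul_neg_of_neg_of_pos (by linarith [hpq y hy']) (mul_pos (hu0 y hy') (hv0 y hy'))
  obtain ⟨r, hr⟩ := hne
  obtain ⟨x, hxS, hxr⟩ := (hla r hr).exists
  have h1 : wronskian u u' v v' r < wronskian u u' v v' x := hanti hxS hr hxr
  have h2 : wronskian u u' v v' x ≤ A :=
    ge_of_tendsto hWa ((hla x hxS).mono fun y hy => (hanti hy.1 hxS hy.2).le)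
  have h3 : B ≤ wronskian u u' v v' r :=
    le_of_tendsto hWb ((hlb r hr).mono fun y hy => (hanti hr hy.1 hy.2).le)
  linarith

theorem exists_sign {S : Set ℝ} (hS : IsPreconnected S) {f : ℝ → ℝ} (hf : ContinuousOn f S)
    (h0 : ∀ r ∈ S, f r ≠ 0) : ∃ s : ℝ, ∀ r ∈ S, 0 < s * f r := by
  by_cases h : ∃ a ∈ S, 0 < f a
  · obtain ⟨a, ha, hfa⟩ := h
    refine ⟨1, fun r hr => ?_⟩
    rw [one_mul]
    by_contra! hn
    obtain ⟨x, hx, hx0⟩ := hS.intermediate_value hr ha hf ⟨hn, hfa.le⟩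
    exact h0 x hx hx0
  · push Not at h
    refine ⟨-1, fun r hr => ?_⟩
    have := lt_of_le_of_ne (h r hr) (h0 r hr)
    linarith

theorem deriv_nonneg_of_pos_right {f : ℝ → ℝ} {f' a : ℝ} (hf : HasDerivAt f f' a) (h0 : f a = 0)
    (hpos : ∀ᶠ x in 𝓝[>] a, 0 < f x) : 0 ≤ f' := by
  have h := (hasDerivAt_iff_tendsto_slope.1 hf).mono_left
    (nhdsWithin_mono a fun x (hx : x ∈ Ioi a) => (ne_of_gt hx : x ≠ a))
  refine ge_of_tendsto h ?_
  filter_upwards [hpos, self_mem_nhdsWithin] with x hx hxa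
  have hxa' : a < x := hxa
  rw [slope_def_field, h0, sub_zero]
  exact (div_pos hx (by linarith)).le

theorem deriv_nonpos_of_pos_left {f : ℝ → ℝ} {f' b : ℝ} (hf : HasDerivAt f f' b) (h0 : f b = 0)
    (hpos : ∀ᶠ x in 𝓝[<] b, 0 < f x) : f' ≤ 0 := by
  have h := (hasDerivAt_iff_tendsto_slope.1 hf).mono_left
    (nhdsWithin_mono b fun x (hx : x ∈ Iio b) => (ne_of_lt hx : x ≠ b))
  refine le_of_tendsto h ?_
  filter_upwards [hpos, self_mem_nhdsWithin] with x hx hxb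
  have hxb' : x < b := hxb
  rw [slope_def_field, h0, sub_zero]
  exact (div_neg_of_pos_of_neg hx (by linarith)).le

theorem wronskian_const_mul (u u' v v' : ℝ → ℝ) (s t : ℝ) :
    wronskian (fun r => s * u r) (fun r => s * u' r) (fun r => t * v r) (fun r => t * v' r)
      = fun r => s * t * wronskian u u' v v' r := by
  ext r; simp only [wronskian]; ring

section Sturm

variable {p q u u' v v' : ℝ → ℝ} {D : Set ℝ} {a b : ℝ}

/-- The boundary condition at the left end `a`: either `u a = 0`, or the Wronskian tends
to `0`. -/
theorem exists_limit_left (hu : IsSolution p u u' D) (hv : IsSolution q v v' D)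
    (hu0 : ∀ᶠ r in 𝓝[>] a, 0 < u r) (hv0 : ∀ᶠ r in 𝓝[>] a, 0 < v r)
    (ha : a ∈ D ∧ u a = 0 ∨ Tendsto (wronskian u u' v v') (𝓝[>] a) (𝓝 0)) :
    ∃ A ≤ 0, Tendsto (wronskian u u' v v') (𝓝[>] a) (𝓝 A) := by
  rcases ha with ⟨haD, ha0⟩ | h
  · refine ⟨_, ?_, (hu.hasDerivAt_wronskian hv haD).continuousAt.tendsto.mono_left
      nhdsWithin_le_nhds⟩
    have h1 := deriv_nonneg_of_pos_right (hu a haD).1 ha0 hu0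
    have h2 : 0 ≤ v a := ge_of_tendsto
      ((hv a haD).1.continuousAt.tendsto.mono_left nhdsWithin_le_nhds) (hv0.mono fun _ h => h.le)
    rw [wronskian, ha0]
    nlinarith [mul_nonneg h1 h2]
  · exact ⟨0, le_rfl, h⟩

/-- As u falls to 0 at b, u'(b) ≤ 0 and the Wronskian there is -u'(b)v(b) ≥ 0. -/
theorem exists_limit_right (hu : IsSolution p u u' D) (hv : IsSolution q v v' D)
    (hu0 : ∀ᶠ r in 𝓝[<] b, 0 < u r) (hv0 : ∀ᶠ r in 𝓝[<] b, 0 < v r) (hbD : b ∈ D)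
    (hb0 : u b = 0) : ∃ B, 0 ≤ B ∧ Tendsto (wronskian u u' v v') (𝓝[<] b) (𝓝 B) := by
  refine ⟨_, ?_, (hu.hasDerivAt_wronskian hv hbD).continuousAt.tendsto.mono_left
    nhdsWithin_le_nhds⟩
  have h1 := deriv_nonpos_of_pos_left (hu b hbD).1 hb0 hu0
  have h2 : 0 ≤ v b := ge_of_tendsto
    ((hv b hbD).1.continuousAt.tendsto.mono_left nhdsWithin_le_nhds) (hv0.mono fun _ h => h.le)
  rw [wronskian, hb0]
  nlinarith [mul_nonneg (neg_nonneg.2 h1) h2]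

theorem left_bdry_const_mul (s t : ℝ)
    (ha : a ∈ D ∧ u a = 0 ∨ Tendsto (wronskian u u' v v') (𝓝[>] a) (𝓝 0)) :
    a ∈ D ∧ s * u a = 0 ∨ Tendsto (wronskian (fun r => s * u r) (fun r => s * u' r)
      (fun r => t * v r) (fun r => t * v' r)) (𝓝[>] a) (𝓝 0) := by
  refine ha.imp (fun h => ⟨h.1, by rw [h.2, mul_zero]⟩) fun h => ?_
  rw [wronskian_const_mul]
  simpa using h.const_mul (s * t)

/-- Sturm comparison on a bounded interval. -/
theorem exists_zero_Ioo (hu : IsSolution p u u' D) (hv : IsSolution q v v' D) (hab : a < b)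
    (hD : Ioo a b ⊆ D) (hpq : ∀ r ∈ Ioo a b, q r < p r) (hu0 : ∀ r ∈ Ioo a b, u r ≠ 0)
    (ha : a ∈ D ∧ u a = 0 ∨ Tendsto (wronskian u u' v v') (𝓝[>] a) (𝓝 0))
    (hbD : b ∈ D) (hb : u b = 0) : ∃ r ∈ Ioo a b, v r = 0 := by
  by_contra! hv0
  -- If v had no zero, both functions would have constant sign. Multiplying by constants makes both
  -- positive and scales the Wronskian, preserving the boundary conditions.
  obtain ⟨s, hs⟩ := exists_sign isPreconnected_Ioo
    (fun r hr => (hu r (hD hr)).1.continuousAt.continuousWithinAt) hu0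
  obtain ⟨t, ht⟩ := exists_sign isPreconnected_Ioo
    (fun r hr => (hv r (hD hr)).1.continuousAt.continuousWithinAt) hv0
  have hr := Ioo_mem_nhdsGT hab
  have hl := Ioo_mem_nhdsLT hab
  obtain ⟨A, hA, hWA⟩ := exists_limit_left (hu.const_mul s) (hv.const_mul t)
    (eventually_of_mem hr hs) (eventually_of_mem hr ht) (left_bdry_const_mul s t ha)
  obtain ⟨B, hB, hWB⟩ := exists_limit_right (hu.const_mul s) (hv.const_mul t)
    (eventually_of_mem hl hs) (eventually_of_mem hl ht) hbD (by simp only [hb, mul_zero])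
  refine false_of_wronskian_limits (convex_Ioo a b) (nonempty_Ioo.2 hab)
    ((hu.const_mul s).mono hD) ((hv.const_mul t).mono hD) hpq hs ht (fun r hr => ?_)
    (fun r hr => ?_) hA hB hWA hWB
  · filter_upwards [Ioo_mem_nhdsGT hr.1] with x hx using ⟨⟨hx.1, hx.2.trans hr.2⟩, hx.2⟩
  · filter_upwards [Ioo_mem_nhdsLT hr.2] with x hx using ⟨⟨hr.1.trans hx.1, hx.2⟩, hx.1⟩

/-- Sturm comparison on a half-line. -/
theorem exists_zero_Ioi (hu : IsSolution p u u' D) (hv : IsSolution q v v' D)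
    (hD : Ioi a ⊆ D) (hpq : ∀ r ∈ Ioi a, q r < p r) (hu0 : ∀ r ∈ Ioi a, u r ≠ 0)
    (ha : a ∈ D ∧ u a = 0 ∨ Tendsto (wronskian u u' v v') (𝓝[>] a) (𝓝 0))
    (hb : Tendsto (wronskian u u' v v') atTop (𝓝 0)) : ∃ r ∈ Ioi a, v r = 0 := by
  by_contra! hv0
  obtain ⟨s, hs⟩ := exists_sign isPreconnected_Ioi
    (fun r hr => (hu r (hD hr)).1.continuousAt.continuousWithinAt) hu0
  obtain ⟨t, ht⟩ := exists_sign isPreconnected_Ioi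
    (fun r hr => (hv r (hD hr)).1.continuousAt.continuousWithinAt) hv0
  have hr : Ioi a ∈ 𝓝[>] a := self_mem_nhdsWithin
  obtain ⟨A, hA, hWA⟩ := exists_limit_left (hu.const_mul s) (hv.const_mul t)
    (eventually_of_mem hr hs) (eventually_of_mem hr ht) (left_bdry_const_mul s t ha)
  refine false_of_wronskian_limits (convex_Ioi a) nonempty_Ioi
    ((hu.const_mul s).mono hD) ((hv.const_mul t).mono hD) hpq hs ht (fun r hr => ?_)
    (lb := atTop) (B := 0) (fun r hr => ?_) hA le_rfl hWA ?_
  · filter_upwards [Ioo_mem_nhdsGT (show a < r from hr)] with x hx using ⟨hx.1, hx.2⟩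
  · filter_upwards [Ioi_mem_atTop r] with x hx
    exact ⟨lt_trans (show a < r from hr) hx, hx⟩
  · rw [wronskian_const_mul]
    simpa using hb.const_mul (s * t)

end Sturm

/-- By compactness, take the last zero before c and the first one after it. -/
theorem exists_consecutive_zeros {u : ℝ → ℝ} {x y c : ℝ} (hu : ContinuousOn u (Icc x y))
    (hc : c ∈ Ioo x y) (hx : u x = 0) (hy : u y = 0) (huc : u c ≠ 0) :
    ∃ a b, x ≤ a ∧ a < b ∧ b ≤ y ∧ u a = 0 ∧ u b = 0 ∧ ∀ r ∈ Ioo a b, u r ≠ 0 := by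
  have h1 : IsCompact (Icc x c ∩ u ⁻¹' {0}) := isCompact_Icc.of_isClosed_subset
    ((hu.mono (Icc_subset_Icc_right hc.2.le)).preimage_isClosed_of_isClosed isClosed_Icc
      isClosed_singleton) inter_subset_left
  have h2 : IsCompact (Icc c y ∩ u ⁻¹' {0}) := isCompact_Icc.of_isClosed_subset
    ((hu.mono (Icc_subset_Icc_left hc.1.le)).preimage_isClosed_of_isClosed isClosed_Icc
      isClosed_singleton) inter_subset_left
  obtain ⟨a, ⟨ha, ha0⟩, hamax⟩ := h1.exists_isGreatest ⟨x, ⟨le_rfl, hc.1.le⟩, hx⟩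
  obtain ⟨b, ⟨hb, hb0⟩, hbmin⟩ := h2.exists_isLeast ⟨y, ⟨hc.2.le, le_rfl⟩, hy⟩
  have hac : a ≠ c := fun h => huc (h ▸ ha0)
  refine ⟨a, b, ha.1, (lt_of_le_of_ne ha.2 hac).trans_le hb.1, hb.2, ha0, hb0, fun r hr h0 => ?_⟩
  rcases le_total r c with h | h
  · exact absurd (hamax ⟨⟨ha.1.trans hr.1.le, h⟩, h0⟩) (not_le.2 hr.1)
  · exact absurd (hbmin ⟨⟨h, hr.2.le.trans hb.2⟩, h0⟩) (not_le.2 hr.2)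

/-- Disconjugacy: if `v'' = q v` has a solution without zeros and `q < p`, then a regular
solution of `u'' = p u` has at most one zero. -/
theorem IsSolution.no_two_zeros {p q u u' v v' : ℝ → ℝ} {x y : ℝ}
    (hu : IsSolution p u u' (Ioi 0)) (hp : ContinuousOn p (Ioi 0)) {l : ℕ}
    (hl : Tendsto (fun r : ℝ => u r / r ^ (l + 1)) (𝓝[>] 0) (𝓝 1)) (hx : 0 < x) (hxy : x < y)
    (hv : IsSolution q v v' (Icc x y)) (hv0 : ∀ r ∈ Icc x y, v r ≠ 0)
    (hpq : ∀ r ∈ Icc x y, q r < p r) (hux : u x = 0) (huy : u y = 0) : False := by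
  have hsub : Icc x y ⊆ Ioi 0 := fun r hr => hx.trans_le hr.1
  -- If u vanished identically between x and y, its Cauchy data at the midpoint would be zero,
  -- contrary to the behaviour r^(l+1) at 0.
  obtain ⟨c, hc, huc⟩ : ∃ c ∈ Ioo x y, u c ≠ 0 := by
    by_contra! h
    have hm : (x + y) / 2 ∈ Ioo x y := ⟨by linarith, by linarith⟩
    have hm0 : (x + y) / 2 ∈ Ioi (0 : ℝ) := hx.trans hm.1
    have hd : HasDerivAt u 0 ((x + y) / 2) := by
      refine (hasDerivAt_const _ (0 : ℝ)).congr_of_eventuallyEq ?_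
      filter_upwards [isOpen_Ioo.mem_nhds hm] with r hr using h r hr
    rcases (hu.mono fun r (hr : r ∈ Ioc 0 _) => hr.1).cauchyData_ne_zero hm0 hp hl with h0 | h0
    · exact h0 (h _ hm)
    · exact h0 ((hu _ hm0).1.unique hd)
  obtain ⟨a, b, hxa, hab, hby, ha0, hb0, hne⟩ := exists_consecutive_zeros
    (fun r hr => (hu r (hsub hr)).1.continuousAt.continuousWithinAt) hc hux huy huc
  have hI : Ioo a b ⊆ Icc x y := fun r hr => ⟨hxa.trans hr.1.le, hr.2.le.trans hby⟩
  obtain ⟨r, hr, hr0⟩ := exists_zero_Ioo (hu.mono hsub) hv hab hI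
    (fun r hr => hpq r (hI hr)) hne (Or.inl ⟨⟨hxa, hab.le.trans hby⟩, ha0⟩)
    ⟨hxa.trans hab.le, hby⟩ hb0
  exact hv0 r (hI hr) hr0

/-- If between any element of `{0} ∪ A` and its successor in `A ∪ {∞}` there is an element of `B`,
then `B` has more elements than `A`. -/
theorem card_lt_card_of_interlacing {A B : Finset ℝ} (hA : ∀ z ∈ A, 0 < z)
    (h : ∀ a ∈ insert 0 A, ∃ y ∈ B, a < y ∧ ∀ z ∈ A, a < z → y < z) : A.card < B.card := by
  choose! f hfB hlt hf using h
  have h0 : (0 : ℝ) ∉ A := fun h => lt_irrefl _ (hA 0 h)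
  -- The chosen points are separated by the elements of A, so they are distinct; the extra left end
  -- 0 makes the final inequality strict.
  have hmono : StrictMonoOn f (insert 0 A : Finset ℝ) := by
    intro a ha b hb hab
    have hb0 : b ≠ 0 := by
      rintro rfl
      rcases Finset.mem_insert.1 ha with rfl | h
      · exact lt_irrefl _ hab
      · exact absurd (hA a h) (not_lt.2 hab.le)
    exact (hf a ha b (Finset.mem_of_mem_insert_of_ne hb hb0) hab).trans (hlt b hb)
  have := Finset.card_le_card_of_injOn f hfB hmono.injOn
  rw [Finset.card_insert_of_notMem h0] at this
  omega

theorem tendsto_wronskian_zero {u u' v v' : ℝ → ℝ} {l : Filter ℝ} (hu : Tendsto u l (𝓝 0))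
    (hv : Tendsto v l (𝓝 0)) (hu' : ∃ C, ∀ᶠ r in l, |u' r| ≤ C)
    (hv' : ∃ C, ∀ᶠ r in l, |v' r| ≤ C) : Tendsto (wronskian u u' v v') l (𝓝 0) := by
  obtain ⟨C, hC⟩ := hu'
  obtain ⟨C', hC'⟩ := hv'
  have h1 : Tendsto (fun r => u r * v' r) l (𝓝 0) :=
    hu.zero_mul_isBoundedUnder_le ⟨C', by simpa using hC'⟩
  have h2 : Tendsto (fun r => u' r * v r) l (𝓝 0) :=
    (isBoundedUnder_le_mul_tendsto_zero ⟨C, by simpa using hC⟩ hv)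
  have h3 := h1.sub h2
  rw [sub_zero] at h3
  exact h3

/-- As l ≥ 1, u = O(r²) cancels the r⁻² singularity of the coefficient. So u'' is bounded near 0,
and the mean value inequality bounds u'. This makes Wronskians of regular solutions vanish at 0. -/
theorem exists_deriv_bound_near_zero {e E : ℝ} {l : ℕ} (hl : 1 ≤ l) {V u u' : ℝ → ℝ}
    (hV : ContinuousOn V (Ici 0)) (hu : IsSolution (radialCoeff e l V E) u u' (Ioi 0))
    (h1 : Tendsto (fun r : ℝ => u r / r ^ (l + 1)) (𝓝[>] 0) (𝓝 1)) :
    ∃ C, ∀ᶠ r in 𝓝[>] (0 : ℝ), |u' r| ≤ C := by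
  obtain ⟨B, hB⟩ := (isCompact_Icc (a := (0 : ℝ)) (b := 1)).exists_bound_of_continuousOn
    ((((hV.mono Icc_subset_Ici_self).sub (continuousOn_const (c := E))).div_const e))
  have h2 : ∀ᶠ r in 𝓝[>] (0 : ℝ), |u r / r ^ (l + 1)| < 2 := by
    have := h1.abs
    rw [abs_one] at this
    exact this.eventually_lt_const (by norm_num)
  obtain ⟨δ, hδ, hδ2⟩ := mem_nhdsGT_iff_exists_Ioo_subset.1 h2
  set η := min (δ / 2) 1 with hη
  have hδ0 : (0 : ℝ) < δ := hδ
  have hη0 : 0 < η := by positivity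
  have hηδ : η < δ := (min_le_left _ _).trans_lt (by linarith)
  have hη1 : η ≤ 1 := min_le_right _ _
  set L : ℝ := (l : ℝ) * (l + 1) with hL
  have hL0 : 0 ≤ L := by positivity
  have hbd : ∀ r ∈ Ioc 0 η, ‖radialCoeff e l V E r * u r‖ ≤ (L + B) * 2 := by
    intro r hr
    have hr1 : r ≤ 1 := hr.2.trans hη1
    have hr0 : 0 < r := hr.1
    have hur : |u r| ≤ 2 * r ^ 2 := by
      have h3 : |u r / r ^ (l + 1)| < 2 := hδ2 ⟨hr.1, hr.2.trans_lt hηδ⟩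
      rw [abs_div, abs_of_pos (by positivity : (0 : ℝ) < r ^ (l + 1)),
        div_lt_iff₀ (by positivity)] at h3
      have h4 : r ^ (l + 1) ≤ r ^ 2 := pow_le_pow_of_le_one hr0.le hr1 (by omega)
      linarith
    have hBr := hB r ⟨hr0.le, hr1⟩
    have hB0 : 0 ≤ B := (norm_nonneg _).trans hBr
    rw [Real.norm_eq_abs] at hBr
    have hc : |radialCoeff e l V E r| ≤ (L + B) / r ^ 2 := by
      rw [radialCoeff]
      refine (abs_add_le _ _).trans ?_
      rw [abs_of_nonneg (by positivity), add_div]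
      refine add_le_add le_rfl (hBr.trans ?_)
      rw [le_div_iff₀ (by positivity)]
      exact mul_le_of_le_one_right hB0 (pow_le_one₀ hr0.le hr1)
    calc ‖radialCoeff e l V E r * u r‖ = |radialCoeff e l V E r| * |u r| := by
          rw [Real.norm_eq_abs, abs_mul]
      _ ≤ (L + B) / r ^ 2 * (2 * r ^ 2) := by gcongr
      _ = (L + B) * 2 := by field_simp
  have hC0 : 0 ≤ (L + B) * 2 := (norm_nonneg _).trans (hbd η ⟨hη0, le_rfl⟩)
  refine ⟨|u' η| + (L + B) * 2, ?_⟩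
  filter_upwards [Ioc_mem_nhdsGT hη0] with r hr
  have h := (convex_Ioc 0 η).norm_image_sub_le_of_norm_hasDerivWithin_le
    (fun x hx => (hu x hx.1).2.hasDerivWithinAt) hbd (right_mem_Ioc.2 hη0) hr
  rw [Real.norm_eq_abs, Real.norm_eq_abs] at h
  have h3 : |r - η| ≤ 1 := abs_le.2 ⟨by linarith [hr.1], by linarith [hr.2]⟩
  have h4 := abs_sub_abs_le_abs_sub (u' r) (u' η)
  nlinarith

/-! ### Finiteness of the spectrum at or below the threshold -/

section Finiteness

variable {e c R : ℝ} {l : ℕ} {V : ℝ → ℝ}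

theorem radialCoeff_lt (he : 0 < e) {E₁ E₂ : ℝ} (h : E₁ < E₂) (r : ℝ) :
    radialCoeff e l V E₂ r < radialCoeff e l V E₁ r := by
  unfold radialCoeff; gcongr

theorem radialCoeff_of_le (hV : ∀ r, R ≤ r → V r = -(c / r ^ 2)) (E : ℝ) {r : ℝ} (hr : R ≤ r) :
    radialCoeff e l V E r = ((l : ℝ) * (l + 1) - c / e) / r ^ 2 - E / e := by
  rw [radialCoeff, hV r hr]; ring

/-- There are no positive eigenvalues. -/
theorem IsRadialEigenvalue.nonpos (he : 0 < e) (hR : 0 < R) (hV : ContinuousOn V (Ioi 0))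
    (hout : ∀ r, R ≤ r → V r = -(c / r ^ 2)) {E : ℝ} (h : IsRadialEigenvalue e l V E) : E ≤ 0 := by
  by_contra! hE
  obtain ⟨u, u', hu, hL, -, h1⟩ := h.exists_isSolution he.ne'
  have hRs : Ici R ⊆ Ioi 0 := fun r hr => hR.trans_le hr
  refine (hu.mono hRs).not_memLp (E := E / e) (C := |(l : ℝ) * (l + 1) - c / e|) hR
    (by positivity) (fun r hr => ?_) ?_
    (hL.mono_measure (Measure.restrict_mono (Ioi_subset_Ioi hR.le) le_rfl))
  · have : 0 < r := hR.trans_le hr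
    rw [radialCoeff_of_le hout E hr, sub_add_cancel, abs_div, abs_of_pos (a := r ^ 2) (by positivity)]
  · exact (hu.mono fun r (hr : r ∈ Ioc 0 R) => hr.1).cauchyData_ne_zero hR
      (continuousOn_radialCoeff e l hV E) h1

/-- For E < 0 the coefficient lies above that of an equation with a zero-free solution, on each of
finitely many cells chosen independently of E. Each cell then contains at most one zero. -/
theorem exists_zero_count_bound (he : 0 < e) (hR : 0 < R)
    (hV : ContinuousOn V (Ici 0)) (hout : ∀ r, R ≤ r → V r = -(c / r ^ 2))
    (hsub : c / e ≤ (l : ℝ) * (l + 1) + 1 / 4) :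
    ∃ N : ℕ, ∀ E < 0, ∀ u u' : ℝ → ℝ, IsSolution (radialCoeff e l V E) u u' (Ioi 0) →
      Tendsto (fun r : ℝ => u r / r ^ (l + 1)) (𝓝[>] 0) (𝓝 1) →
      {r | 0 < r ∧ u r = 0}.Finite ∧ {r | 0 < r ∧ u r = 0}.ncard ≤ N := by
  obtain ⟨P, hP⟩ := (isCompact_Icc (a := (0 : ℝ)) (b := R)).exists_bound_of_continuousOn
    ((hV.mono Icc_subset_Ici_self).div_const e)
  have hP0 : 0 ≤ P := (norm_nonneg _).trans (hP 0 ⟨le_rfl, hR.le⟩)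
  -- Then ω² > P, so the coefficient exceeds -ω² on (0, R). Cells of length 1/ω keep the phase of
  -- the comparison cosine below 1 < π/2.
  set ω := P + 1 with hω
  have hω0 : 0 < ω := by positivity
  set K := ⌊ω * R⌋₊ with hK
  -- Labels 0, …, K cover (0, R) and the single label K + 1 covers the whole tail, which accounts
  -- for the bound K + 2.
  set cell : ℝ → ℕ := fun r => if r < R then ⌊ω * r⌋₊ else K + 1 with hcell
  refine ⟨K + 2, fun E hE u u' hu h1 => ?_⟩
  have hpc := continuousOn_radialCoeff e l (hV.mono Ioi_subset_Ici_self) E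
  have hkey : ∀ x y, 0 < x → x < y → u x = 0 → u y = 0 → cell x ≠ cell y := by
    intro x y hx hxy hux huy hxy'
    have hfl : ∀ r, r < R → ⌊ω * r⌋₊ ≤ K := fun r hr =>
      Nat.floor_le_floor (mul_le_mul_of_nonneg_left hr.le hω0.le)
    by_cases hyR : y < R
    · have hxR := hxy.trans hyR
      simp only [hcell, if_pos hxR, if_pos hyR] at hxy'
      have hd : ω * y - ω * x < 1 := by
        have e1 := Nat.floor_le (mul_pos hω0 hx).le
        have e2 := Nat.lt_floor_add_one (ω * y)
        rw [← hxy'] at e2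
        linarith
      have hv : IsSolution (fun _ => -ω ^ 2) (fun r => Real.cos (ω * (r - x)))
          (fun r => -(ω * Real.sin (ω * (r - x)))) (Icc x y) := by
        intro r _
        have hi : HasDerivAt (fun r => ω * (r - x)) ω r := by
          simpa using ((hasDerivAt_id r).sub_const x).const_mul ω
        exact ⟨hi.cos.congr_deriv (by ring), (hi.sin.const_mul ω).neg.congr_deriv (by ring)⟩
      refine hu.no_two_zeros hpc h1 hx hxy hv (fun r hr => ?_) (fun r hr => ?_) hux huy
      · refine (Real.cos_pos_of_mem_Ioo ⟨?_, ?_⟩).ne'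
        · have := mul_nonneg hω0.le (sub_nonneg.2 hr.1)
          linarith [Real.pi_pos]
        · have := mul_le_mul_of_nonneg_left hr.2 hω0.le
          nlinarith [Real.pi_gt_three]
      · have hr0 : 0 < r := hx.trans_le hr.1
        have hb := (abs_le.1 (hP r ⟨hr0.le, (hr.2.trans_lt hyR).le⟩)).1
        have hE' : E / e < 0 := div_neg_of_neg_of_pos hE he
        have h5 : 0 ≤ (l : ℝ) * (l + 1) / r ^ 2 := by positivity
        have h6 : P < ω ^ 2 := by rw [hω]; nlinarith
        rw [radialCoeff, sub_div]
        linarith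
    · have hxR : ¬ x < R := by
        intro hxR
        simp only [hcell, if_pos hxR, if_neg hyR] at hxy'
        have := hfl x hxR
        omega
      rw [not_lt] at hxR
      -- √r is a zero-free solution at the critical Hardy constant. The coefficient stays strictly
      -- above -1/(4r²) even at the threshold, because -E/e > 0.
      have hv : IsSolution (fun r => -(1 / 4) / r ^ 2) (fun r => √r)
          (fun r => 1 / (2 * √r)) (Icc x y) := by
        intro r hr
        have hr0 : 0 < r := hx.trans_le hr.1
        have hs : 0 < √r := Real.sqrt_pos.2 hr0
        have hsq : √r ^ 2 = r := Real.sq_sqrt hr0.le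
        have h2 := Real.hasDerivAt_sqrt hr0.ne'
        refine ⟨h2, ((hasDerivAt_const r (1 : ℝ)).div (h2.const_mul 2) (by positivity)).congr_deriv
          ?_⟩
        rw [← hsq]
        simp only [Real.sqrt_sq hs.le]
        field_simp
        ring
      refine hu.no_two_zeros hpc h1 hx hxy hv (fun r hr => ?_) (fun r hr => ?_) hux huy
      · exact (Real.sqrt_pos.2 (hx.trans_le hr.1)).ne'
      · have hr0 : 0 < r := hx.trans_le hr.1
        have hE' : E / e < 0 := div_neg_of_neg_of_pos hE he
        rw [radialCoeff_of_le hout E (hxR.trans hr.1)]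
        have : -(1 / 4) / r ^ 2 ≤ ((l : ℝ) * (l + 1) - c / e) / r ^ 2 := by
          gcongr; linarith
        linarith
  have hinj : InjOn cell {r | 0 < r ∧ u r = 0} := by
    intro x hx y hy hxy
    rcases lt_trichotomy x y with h | h | h
    · exact absurd hxy (hkey x y hx.1 h hx.2 hy.2)
    · exact h
    · exact absurd hxy.symm (hkey y x hy.1 h hy.2 hx.2)
  have hmaps : MapsTo cell {r | 0 < r ∧ u r = 0} (Iio (K + 2)) := by
    intro r _
    by_cases h : r < R
    · have : ⌊ω * r⌋₊ ≤ K := Nat.floor_le_floor (mul_le_mul_of_nonneg_left h.le hω0.le)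
      simp only [hcell, if_pos h, mem_Iio]; omega
    · simp only [hcell, if_neg h, mem_Iio]; omega
  refine ⟨Set.Finite.of_injOn hmaps hinj (finite_Iio _), ?_⟩
  have := Set.ncard_le_ncard_of_injOn cell hmaps hinj (finite_Iio _)
  rwa [← Finset.coe_Iio, Set.ncard_coe_finset, Nat.card_Iio] at this

/-- Sturm oscillation: a higher negative eigenvalue has an eigenfunction with more zeros. -/
theorem ncard_zeros_lt (he : 0 < e) (hR : 0 < R) (hl : 1 ≤ l)
    (hV : ContinuousOn V (Ici 0)) (hout : ∀ r, R ≤ r → V r = -(c / r ^ 2))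
    {E₁ E₂ : ℝ} (hE : E₁ < E₂) (hE₂ : E₂ < 0) {u u' v v' : ℝ → ℝ}
    (hu : IsSolution (radialCoeff e l V E₁) u u' (Ioi 0))
    (hv : IsSolution (radialCoeff e l V E₂) v v' (Ioi 0))
    (hLu : MemLp u 2 (volume.restrict (Ioi 0))) (hLv : MemLp v 2 (volume.restrict (Ioi 0)))
    (hu0 : Tendsto u (𝓝[>] 0) (𝓝 0)) (hv0 : Tendsto v (𝓝[>] 0) (𝓝 0))
    (hu1 : Tendsto (fun r : ℝ => u r / r ^ (l + 1)) (𝓝[>] 0) (𝓝 1))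
    (hv1 : Tendsto (fun r : ℝ => v r / r ^ (l + 1)) (𝓝[>] 0) (𝓝 1))
    (hfu : {r | 0 < r ∧ u r = 0}.Finite) (hfv : {r | 0 < r ∧ v r = 0}.Finite) :
    {r | 0 < r ∧ u r = 0}.ncard < {r | 0 < r ∧ v r = 0}.ncard := by
  have hW0 := tendsto_wronskian_zero hu0 hv0 (exists_deriv_bound_near_zero hl hV hu hu1)
    (exists_deriv_bound_near_zero hl hV hv hv1)
  -- Both energies are negative, so both coefficients are nonnegative far out. Then the
  -- eigenfunctions decay with bounded derivatives and the Wronskian tends to 0 at infinity.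
  obtain ⟨T, hTR, hT⟩ : ∃ T, R ≤ T ∧ ∀ E ≤ E₂, ∀ r, T ≤ r → 0 ≤ radialCoeff e l V E r := by
    have ht : Tendsto (fun r : ℝ => ((l : ℝ) * (l + 1) - c / e) / r ^ 2) atTop (𝓝 0) :=
      tendsto_const_nhds.div_atTop (tendsto_pow_atTop two_ne_zero)
    have hE' : E₂ / e < 0 := div_neg_of_neg_of_pos hE₂ he
    obtain ⟨T, hT⟩ := eventually_atTop.1 (ht.eventually_const_lt hE')
    refine ⟨max R T, le_max_left _ _, fun E hEE r hr => ?_⟩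
    rw [radialCoeff_of_le hout E ((le_max_left _ _).trans hr)]
    have h1 := hT r ((le_max_right _ _).trans hr)
    have h2 : E / e ≤ E₂ / e := by gcongr
    linarith
  have hT0 : 0 < T := hR.trans_le hTR
  have hTs : Ici T ⊆ Ioi 0 := fun r hr => hT0.trans_le hr
  have hTm : volume.restrict (Ioi T) ≤ volume.restrict (Ioi (0 : ℝ)) :=
    Measure.restrict_mono (Ioi_subset_Ioi hT0.le) le_rfl
  obtain ⟨hu2, C, hC⟩ := (hu.mono hTs).tendsto_zero (hT E₁ hE.le) (hLu.mono_measure hTm)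
  obtain ⟨hv2, C', hC'⟩ := (hv.mono hTs).tendsto_zero (hT E₂ le_rfl) (hLv.mono_measure hTm)
  have hWinf := tendsto_wronskian_zero hu2 hv2
    ⟨C, (eventually_ge_atTop T).mono hC⟩ ⟨C', (eventually_ge_atTop T).mono hC'⟩
  rw [Set.ncard_eq_toFinset_card _ hfu, Set.ncard_eq_toFinset_card _ hfv]
  refine card_lt_card_of_interlacing (fun z hz => ((Set.Finite.mem_toFinset hfu).1 hz).1)
    fun a ha => ?_
  have ha' : 0 ≤ a ∧ (a ∈ Ioi (0 : ℝ) ∧ u a = 0 ∨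
      Tendsto (wronskian u u' v v') (𝓝[>] a) (𝓝 0)) := by
    rcases Finset.mem_insert.1 ha with rfl | h
    · exact ⟨le_rfl, Or.inr hW0⟩
    · have := (Set.Finite.mem_toFinset hfu).1 h
      exact ⟨this.1.le, Or.inl this⟩
  -- Either a has a next zero b of u, or u has no zero beyond a and comparison runs on the
  -- half-line.
  by_cases hex : (hfu.toFinset.filter (a < ·)).Nonempty
  · obtain ⟨b, hb, hmin⟩ := Finset.exists_min_image _ id hex
    rw [Finset.mem_filter, Set.Finite.mem_toFinset] at hb
    have hne : ∀ r ∈ Ioo a b, u r ≠ 0 := fun r hr h0 => absurd (hmin r (Finset.mem_filter.2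
      ⟨(Set.Finite.mem_toFinset hfu).2 ⟨ha'.1.trans_lt hr.1, h0⟩, hr.1⟩)) (not_le.2 hr.2)
    obtain ⟨y, hy, hy0⟩ := exists_zero_Ioo hu hv hb.2 (fun r hr => ha'.1.trans_lt hr.1)
      (fun r _ => radialCoeff_lt he hE r) hne ha'.2 hb.1.1 hb.1.2
    exact ⟨y, (Set.Finite.mem_toFinset hfv).2 ⟨ha'.1.trans_lt hy.1, hy0⟩, hy.1,
      fun z hz haz => hy.2.trans_le (hmin z (Finset.mem_filter.2 ⟨hz, haz⟩))⟩
  · have hne : ∀ r ∈ Ioi a, u r ≠ 0 := fun r hr h0 => hex ⟨r, Finset.mem_filter.2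
      ⟨(Set.Finite.mem_toFinset hfu).2 ⟨ha'.1.trans_lt hr, h0⟩, hr⟩⟩
    obtain ⟨y, hy, hy0⟩ := exists_zero_Ioi hu hv (fun r hr => ha'.1.trans_lt hr)
      (fun r _ => radialCoeff_lt he hE r) hne ha'.2 hWinf
    exact ⟨y, (Set.Finite.mem_toFinset hfv).2 ⟨ha'.1.trans_lt hy, hy0⟩, hy, fun z hz haz =>
      absurd ⟨z, Finset.mem_filter.2 ⟨hz, haz⟩⟩ hex⟩

/-- In the subcritical case there are only finitely many eigenvalues. -/
theorem finite_eigenvalues (he : 0 < e) (hR : 0 < R) (hl : 1 ≤ l)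
    (hV : ContinuousOn V (Ici 0)) (hout : ∀ r, R ≤ r → V r = -(c / r ^ 2))
    (hsub : c / e ≤ (l : ℝ) * (l + 1) + 1 / 4) : {E | IsRadialEigenvalue e l V E}.Finite := by
  obtain ⟨N, hN⟩ := exists_zero_count_bound he hR hV hout hsub
  have hneg : {E | IsRadialEigenvalue e l V E ∧ E < 0}.Finite := by
    have hex : ∀ E ∈ {E | IsRadialEigenvalue e l V E ∧ E < 0}, _ := fun E hE =>
      IsRadialEigenvalue.exists_isSolution he.ne' hE.1
    choose! u u' hu hL h0 h1 using hex
    have hmono : StrictMonoOn (fun E => {r | 0 < r ∧ u E r = 0}.ncard)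
        {E | IsRadialEigenvalue e l V E ∧ E < 0} := fun E₁ hE₁ E₂ hE₂ hlt =>
      ncard_zeros_lt he hR hl hV hout hlt hE₂.2 (hu _ hE₁) (hu _ hE₂) (hL _ hE₁) (hL _ hE₂)
        (h0 _ hE₁) (h0 _ hE₂) (h1 _ hE₁) (h1 _ hE₂)
        (hN _ hE₁.2 _ _ (hu _ hE₁) (h1 _ hE₁)).1 (hN _ hE₂.2 _ _ (hu _ hE₂) (h1 _ hE₂)).1
    exact Set.Finite.of_injOn (t := Iic N)
      (fun E hE => (hN _ hE.2 _ _ (hu _ hE) (h1 _ hE)).2) hmono.injOn (finite_Iic N)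
  -- The oscillation argument needs E < 0; E = 0 adds at most one point.
  refine (hneg.insert 0).subset fun E hE => ?_
  rcases (IsRadialEigenvalue.nonpos he hR (hV.mono Ioi_subset_Ici_self) hout hE).eq_or_lt with h | h
  · exact Or.inl h
  · exact Or.inr ⟨hE, h⟩

end Finiteness

/-! ### Volterra equation for the regular solution -/

section Volterra

variable {L : ℝ}

/-- The primitive vanishing at `0`, as an operator on `C([0, L])`. -/
def primitiveCLM (hL : 0 ≤ L) : C(Icc (0 : ℝ) L, ℝ) →L[ℝ] C(Icc (0 : ℝ) L, ℝ) :=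
  LinearMap.mkContinuous
    { toFun := fun f => ⟨fun r => ∫ s in (0 : ℝ)..r, IccExtend hL f s,
        (intervalIntegral.continuous_primitive
          (fun _ _ => (f.continuous.Icc_extend' (h := hL)).intervalIntegrable _ _) 0).comp
          continuous_subtype_val⟩
      map_add' := fun f g => by
        ext r
        simp only [ContinuousMap.coe_mk, ContinuousMap.add_apply]
        rw [← intervalIntegral.integral_add
          ((f.continuous.Icc_extend' (h := hL)).intervalIntegrable _ _)
          ((g.continuous.Icc_extend' (h := hL)).intervalIntegrable _ _)]
        rfl
      map_smul' := fun c f => by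
        ext r
        simp only [ContinuousMap.coe_mk, ContinuousMap.smul_apply, RingHom.id_apply, smul_eq_mul]
        rw [← intervalIntegral.integral_const_mul]
        rfl } L fun f => by
    refine (ContinuousMap.norm_le _ (by positivity)).2 fun r => ?_
    have h := intervalIntegral.norm_integral_le_of_norm_le_const (a := 0) (b := r)
      (f := IccExtend hL f) (C := ‖f‖) fun x _ => f.norm_coe_le_norm _
    rw [sub_zero, abs_of_nonneg r.2.1] at h
    refine h.trans ?_
    rw [mul_comm]
    exact mul_le_mul_of_nonneg_right r.2.2 (norm_nonneg _)

theorem primitiveCLM_apply (hL : 0 ≤ L) (f : C(Icc (0 : ℝ) L, ℝ)) (r : Icc (0 : ℝ) L) :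
    primitiveCLM hL f r = ∫ s in (0 : ℝ)..r, IccExtend hL f s := rfl

/-- `f ↦ (s ↦ s⁻ⁿ ∫₀ˢ tⁿ f t dt)`, written as `s ↦ s ∫₀¹ σⁿ f (s σ) dσ`. -/
def averageCLM (hL : 0 ≤ L) (n : ℕ) : C(Icc (0 : ℝ) L, ℝ) →L[ℝ] C(Icc (0 : ℝ) L, ℝ) :=
  have hc : ∀ f : C(Icc (0 : ℝ) L, ℝ),
      Continuous (Function.uncurry fun s σ : ℝ => σ ^ n * IccExtend hL f (s * σ)) := fun f => by
    have := f.continuous.Icc_extend' (h := hL)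
    unfold Function.uncurry
    fun_prop
  have hc' : ∀ (f : C(Icc (0 : ℝ) L, ℝ)) (s : ℝ),
      Continuous fun σ : ℝ => σ ^ n * IccExtend hL f (s * σ) := fun f s => by
    have := f.continuous.Icc_extend' (h := hL)
    fun_prop
  -- The rescaled form has no division by sⁿ, so continuity at s = 0 and the norm bound L are
  -- immediate.
  LinearMap.mkContinuous
    { toFun := fun f => ⟨fun s => s * ∫ σ in (0 : ℝ)..1, σ ^ n * IccExtend hL f (s * σ),
        (continuous_id.mul (intervalIntegral.continuous_parametric_intervalIntegral_of_continuous'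
          (hc f) 0 1)).comp continuous_subtype_val⟩
      map_add' := fun f g => by
        ext s
        simp only [ContinuousMap.coe_mk, ContinuousMap.add_apply]
        rw [← mul_add, ← intervalIntegral.integral_add ((hc' f s).intervalIntegrable _ _)
          ((hc' g s).intervalIntegrable _ _)]
        simp only [← mul_add]
        rfl
      map_smul' := fun c f => by
        ext s
        simp only [ContinuousMap.coe_mk, ContinuousMap.smul_apply, RingHom.id_apply, smul_eq_mul]
        change (s : ℝ) * ∫ σ in (0 : ℝ)..1, σ ^ n * (c * IccExtend hL f (s * σ)) = _
        simp only [mul_left_comm _ c, intervalIntegral.integral_const_mul] } L fun f => by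
    refine (ContinuousMap.norm_le _ (by positivity)).2 fun s => ?_
    have h := intervalIntegral.norm_integral_le_of_norm_le_const (a := 0) (b := 1)
      (f := fun σ : ℝ => σ ^ n * IccExtend hL f (s * σ)) (C := ‖f‖) fun x hx => by
        rw [uIoc_of_le zero_le_one] at hx
        rw [norm_mul, norm_pow, Real.norm_eq_abs, abs_of_pos hx.1]
        exact (mul_le_of_le_one_left (norm_nonneg _) (pow_le_one₀ hx.1.le hx.2)).trans
          (f.norm_coe_le_norm _)
    rw [sub_zero, abs_one, mul_one] at h
    change ‖(s : ℝ) * ∫ σ in (0 : ℝ)..1, σ ^ n * IccExtend hL f (s * σ)‖ ≤ L * ‖f‖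
    rw [norm_mul, Real.norm_eq_abs, abs_of_nonneg s.2.1]
    exact mul_le_mul s.2.2 h (norm_nonneg _) hL

theorem averageCLM_apply (hL : 0 ≤ L) (n : ℕ) (f : C(Icc (0 : ℝ) L, ℝ)) (s : Icc (0 : ℝ) L) :
    averageCLM hL n f s = s * ∫ σ in (0 : ℝ)..1, σ ^ n * IccExtend hL f (s * σ) := rfl

theorem abs_averageCLM_le (hL : 0 ≤ L) (n : ℕ) (f : C(Icc (0 : ℝ) L, ℝ)) (s : Icc (0 : ℝ) L)
    {B : ℝ} (hB : ∀ t : Icc (0 : ℝ) L, t ≤ s → |f t| ≤ B) : |averageCLM hL n f s| ≤ L * B := by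
  have h := intervalIntegral.norm_integral_le_of_norm_le_const (a := 0) (b := 1)
    (f := fun σ : ℝ => σ ^ n * IccExtend hL f (s * σ)) (C := B) fun x hx => by
      rw [uIoc_of_le zero_le_one] at hx
      have h0 : 0 ≤ (s : ℝ) * x := mul_nonneg s.2.1 hx.1.le
      have h1 : (s : ℝ) * x ≤ s := mul_le_of_le_one_right s.2.1 hx.2
      rw [norm_mul, norm_pow, Real.norm_eq_abs, abs_of_pos hx.1,
        IccExtend_of_mem hL f ⟨h0, h1.trans s.2.2⟩]
      exact (mul_le_of_le_one_left (norm_nonneg _) (pow_le_one₀ hx.1.le hx.2)).trans (hB _ h1)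
  rw [sub_zero, abs_one, mul_one] at h
  rw [averageCLM_apply, abs_mul, abs_of_nonneg s.2.1]
  exact mul_le_mul s.2.2 h (abs_nonneg _) hL

theorem averageCLM_eq (hL : 0 ≤ L) (n : ℕ) (f : C(Icc (0 : ℝ) L, ℝ)) {s : ℝ} (hs : s ∈ Icc 0 L)
    (hs0 : s ≠ 0) :
    averageCLM hL n f ⟨s, hs⟩ = (∫ t in (0 : ℝ)..s, t ^ n * IccExtend hL f t) / s ^ n := by
  have h := intervalIntegral.mul_integral_comp_mul_left (a := 0) (b := 1) (c := s)
    (f := fun t => t ^ n * IccExtend hL f t)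
  rw [mul_zero, mul_one] at h
  rw [averageCLM_apply, ← h, eq_div_iff (by positivity), mul_assoc,
    ← intervalIntegral.integral_mul_const]
  congr 2
  ext σ
  rw [mul_pow]
  ring

/-- The integral operator of the equation `(rⁿ h')' = rⁿ q h`, `h(0) = 0`. -/
def volterra (hL : 0 ≤ L) (n : ℕ) (q : C(Icc (0 : ℝ) L, ℝ)) :
    C(Icc (0 : ℝ) L, ℝ) →L[ℝ] C(Icc (0 : ℝ) L, ℝ) :=
  primitiveCLM hL ∘L averageCLM hL n ∘L ContinuousLinearMap.mul ℝ _ q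

theorem volterra_apply (hL : 0 ≤ L) (n : ℕ) (q f : C(Icc (0 : ℝ) L, ℝ)) :
    volterra hL n q f = primitiveCLM hL (averageCLM hL n (q * f)) := rfl

theorem continuous_volterra (hL : 0 ≤ L) (n : ℕ) : Continuous (volterra hL n) := by
  exact continuous_const.clm_comp
    (continuous_const.clm_comp (ContinuousLinearMap.mul ℝ _).continuous)

/-- Averaging and multiplication by q cost at most L‖q‖, and the outer integration turns sᵏ/k! into
rᵏ⁺¹/(k+1)!. High powers are therefore small for every q. -/
theorem abs_volterra_pow_le (hL : 0 ≤ L) (n : ℕ) (q f : C(Icc (0 : ℝ) L, ℝ)) (k : ℕ)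
    (r : Icc (0 : ℝ) L) :
    |((volterra hL n q) ^ k) f r| ≤ (L * ‖q‖ * r) ^ k / (k.factorial : ℝ) * ‖f‖ := by
  induction k generalizing r with
  | zero => simpa using f.norm_coe_le_norm r
  | succ k ih =>
    rw [pow_succ', mul_apply_eq_comp, volterra_apply, primitiveCLM_apply]
    set F := ((volterra hL n q) ^ k) f with hF
    have hC : 0 ≤ L * ‖q‖ := by positivity
    have hb : ∀ s ∈ Icc 0 (r : ℝ), ‖IccExtend hL (averageCLM hL n (q * F)) s‖ ≤
        (L * ‖q‖) ^ (k + 1) / (k.factorial : ℝ) * ‖f‖ * s ^ k := by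
      intro s hs
      rw [IccExtend_of_mem hL _ ⟨hs.1, hs.2.trans r.2.2⟩]
      have := abs_averageCLM_le hL n (q * F) ⟨s, hs.1, hs.2.trans r.2.2⟩
        (B := ‖q‖ * ((L * ‖q‖ * s) ^ k / (k.factorial : ℝ) * ‖f‖)) fun t ht => by
          rw [ContinuousMap.mul_apply, abs_mul]
          refine mul_le_mul (q.norm_coe_le_norm t) ((ih t).trans ?_) (abs_nonneg _) (norm_nonneg _)
          have ht' : (t : ℝ) ≤ s := ht
          have := t.2.1
          gcongr
      refine (Real.norm_eq_abs _).le.trans (this.trans_eq ?_)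
      ring
    have hi := intervalIntegral.norm_integral_le_of_norm_le (μ := volume) r.2.1
      (ae_of_all _ fun s (hs : s ∈ Ioc 0 (r : ℝ)) => hb s ⟨hs.1.le, hs.2⟩)
      (Continuous.intervalIntegrable (by fun_prop) _ _)
    rw [Real.norm_eq_abs] at hi
    refine hi.trans_eq ?_
    rw [intervalIntegral.integral_const_mul, integral_pow, Nat.factorial_succ]
    push_cast
    field_simp
    ring

/-- For large k, ‖Tᵏ‖ < 1, so 1 - Tᵏ = (1 - T)ΣTⁱ is a unit; commuting factors of a unit are units.
-/
theorem isUnit_one_sub_volterra (hL : 0 ≤ L) (n : ℕ) (q : C(Icc (0 : ℝ) L, ℝ)) :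
    IsUnit (1 - volterra hL n q) := by
  set T := volterra hL n q with hT
  have hlim := FloorSemiring.tendsto_pow_div_factorial_atTop (L * ‖q‖ * L)
  obtain ⟨k, hk⟩ := (hlim.eventually_lt_const one_pos).exists
  have hnorm : ‖T ^ k‖ < 1 := by
    refine (ContinuousLinearMap.opNorm_le_bound _ (by positivity) fun f => ?_).trans_lt hk
    refine (ContinuousMap.norm_le _ (by positivity)).2 fun r => ?_
    refine (abs_volterra_pow_le hL n q f k r).trans ?_
    have := r.2.1
    have := r.2.2
    gcongr
  have hu := isUnit_one_sub_of_norm_lt_one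
    (R := C(Icc (0 : ℝ) L, ℝ) →L[ℝ] C(Icc (0 : ℝ) L, ℝ)) hnorm
  rw [← mul_neg_geom_sum] at hu
  have hcomm : Commute (1 - T) (∑ i ∈ Finset.range k, T ^ i) := by
    refine Commute.sum_right _ _ _ fun i _ => ?_
    exact ((Commute.one_left _).sub_left (Commute.refl T)).pow_right i
  exact (hcomm.isUnit_mul_iff.1 hu).1

/-- The solution of `h = 1 + volterra q h`. -/
def volterraSol (hL : 0 ≤ L) (n : ℕ) (q : C(Icc (0 : ℝ) L, ℝ)) : C(Icc (0 : ℝ) L, ℝ) :=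
  Ring.inverse (1 - volterra hL n q) 1

theorem volterraSol_eq (hL : 0 ≤ L) (n : ℕ) (q : C(Icc (0 : ℝ) L, ℝ)) :
    volterraSol hL n q = 1 + primitiveCLM hL (averageCLM hL n (q * volterraSol hL n q)) := by
  have h := Ring.mul_inverse_cancel _ (isUnit_one_sub_volterra hL n q)
  have h1 := congrArg (fun T : C(Icc (0 : ℝ) L, ℝ) →L[ℝ] C(Icc (0 : ℝ) L, ℝ) => T 1) h
  simp only [mul_apply_eq_comp, sub_apply, one_apply_eq_self] at h1
  rw [← volterra_apply]
  exact sub_eq_iff_eq_add.1 h1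

/-- Inversion in a Banach algebra is continuous at units; this yields the continuous dependence on
the energy. -/
theorem continuous_volterraSol (hL : 0 ≤ L) (n : ℕ) : Continuous (volterraSol hL n) := by
  rw [continuous_iff_continuousAt]
  intro q
  obtain ⟨x, hx⟩ := isUnit_one_sub_volterra hL n q
  have h1 : ContinuousAt (fun q => Ring.inverse (1 - volterra hL n q)) q := by
    have h2 := NormedRing.inverse_continuousAt
      (R := C(Icc (0 : ℝ) L, ℝ) →L[ℝ] C(Icc (0 : ℝ) L, ℝ)) x
    rw [hx] at h2
    exact ContinuousAt.comp (f := fun q => 1 - volterra hL n q) h2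
      (continuous_const.sub (continuous_volterra hL n)).continuousAt
  exact h1.clm_apply continuousAt_const

end Volterra

/-! ### Solutions regular at the origin -/

section Regular

variable {L : ℝ}

theorem hasDerivAt_primitiveCLM (hL : 0 ≤ L) (f : C(Icc (0 : ℝ) L, ℝ)) {r : ℝ}
    (hr : r ∈ Ioo 0 L) :
    HasDerivAt (IccExtend hL (primitiveCLM hL f)) (IccExtend hL f r) r := by
  refine ((f.continuous.Icc_extend' (h := hL)).integral_hasStrictDerivAt 0 r).hasDerivAt
    |>.congr_of_eventuallyEq ?_
  filter_upwards [isOpen_Ioo.mem_nhds hr] with x hx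
  rw [IccExtend_of_mem hL _ (Ioo_subset_Icc_self hx), primitiveCLM_apply]

/-- The average d solves (rⁿd)' = rⁿf. With d = h' and f = qh this is the equation for h. -/
theorem hasDerivAt_averageCLM (hL : 0 ≤ L) (n : ℕ) (f : C(Icc (0 : ℝ) L, ℝ)) {r : ℝ}
    (hr : r ∈ Ioo 0 L) :
    HasDerivAt (IccExtend hL (averageCLM hL n f))
      (IccExtend hL f r - n / r * IccExtend hL (averageCLM hL n f) r) r := by
  have hr0 : r ≠ 0 := hr.1.ne'
  have hev : ∀ x ∈ Ioo 0 L, IccExtend hL (averageCLM hL n f) x =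
      (∫ t in (0 : ℝ)..x, t ^ n * IccExtend hL f t) / x ^ n := fun x hx => by
    rw [IccExtend_of_mem hL _ (Ioo_subset_Icc_self hx), averageCLM_eq hL n f _ hx.1.ne']
  have hc : Continuous fun t : ℝ => t ^ n * IccExtend hL f t :=
    (continuous_pow n).mul (f.continuous.Icc_extend' (h := hL))
  have h := ((hc.integral_hasStrictDerivAt 0 r).hasDerivAt.div (hasDerivAt_pow n r)
    (pow_ne_zero n hr0)).congr_of_eventuallyEq (f₁ := IccExtend hL (averageCLM hL n f)) (by
      filter_upwards [isOpen_Ioo.mem_nhds hr] with x hx using hev x hx)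
  refine h.congr_deriv ?_
  rw [hev r hr]
  rcases n with - | n
  · simp
  · simp only [Nat.add_sub_cancel]
    field_simp
    ring

/-- The solutions of `u'' = (l (l + 1) / r² + q + z) u` that behave like `r ^ (l + 1)` at `0`
depend continuously on `z`. -/
theorem exists_regular_solution (hL : 0 < L) (l : ℕ) {q : ℝ → ℝ} (hq : ContinuousOn q (Icc 0 L)) :
    ∃ φ φ' : ℝ → ℝ → ℝ,
      (∀ z, IsSolution (fun r => (l : ℝ) * (l + 1) / r ^ 2 + (q r + z)) (φ z) (φ' z) (Ioo 0 L)) ∧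
      (∀ z, Tendsto (fun r : ℝ => φ z r / r ^ (l + 1)) (𝓝[>] 0) (𝓝 1)) ∧
      (∀ z, Continuous (φ z) ∧ φ z 0 = 0) ∧
      ∀ r, Continuous (fun z => φ z r) ∧ Continuous (fun z => φ' z r) := by
  set qc : ℝ → C(Icc (0 : ℝ) L, ℝ) := fun z =>
    ⟨fun r => q r, continuousOn_iff_continuous_domRestrict.1 hq⟩ + z • 1 with hqc
  have hqcont : Continuous qc := by fun_prop
  -- Putting u = r^(l+1) h turns the equation into (r^(2l+2) h')' = r^(2l+2)(q + z)h with h(0) = 1,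
  -- whence the exponent 2l + 2; `d` below is h'.
  set h : ℝ → C(Icc (0 : ℝ) L, ℝ) := fun z => volterraSol hL.le (2 * l + 2) (qc z) with hh
  have hhcont : Continuous h := (continuous_volterraSol hL.le _).comp hqcont
  set d : ℝ → C(Icc (0 : ℝ) L, ℝ) := fun z => averageCLM hL.le (2 * l + 2) (qc z * h z) with hd
  have hdcont : Continuous d := (averageCLM hL.le _).continuous.comp (hqcont.mul hhcont)
  have hheq : ∀ z, h z = 1 + primitiveCLM hL.le (d z) := fun z => volterraSol_eq hL.le _ _
  have hheq' : ∀ z r, IccExtend hL.le (h z) r = 1 + IccExtend hL.le (primitiveCLM hL.le (d z)) r :=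
    fun z r => by
      conv_lhs => rw [hheq z]
      rfl
  have hext : ∀ f : ℝ → C(Icc (0 : ℝ) L, ℝ), Continuous f → ∀ r,
      Continuous fun z => IccExtend hL.le (f z) r := fun f hf r =>
    (continuous_eval_const _).comp hf
  refine ⟨fun z r => r ^ (l + 1) * IccExtend hL.le (h z) r, fun z r =>
    (l + 1) * r ^ l * IccExtend hL.le (h z) r + r ^ (l + 1) * IccExtend hL.le (d z) r,
    fun z r hr => ?_, fun z => ?_, fun z => ⟨?_, by simp⟩, fun r => ⟨?_, ?_⟩⟩
  · have hr0 : r ≠ 0 := hr.1.ne'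
    have h1 : HasDerivAt (IccExtend hL.le (h z)) (IccExtend hL.le (d z) r) r := by
      refine ((hasDerivAt_primitiveCLM hL.le (d z) hr).const_add 1).congr_of_eventuallyEq ?_
      exact Eventually.of_forall fun x => hheq' z x
    have h2 := hasDerivAt_averageCLM hL.le (2 * l + 2) (qc z * h z) hr
    have hqh : IccExtend hL.le (qc z * h z : C(Icc (0 : ℝ) L, ℝ)) r =
        (q r + z) * IccExtend hL.le (h z) r := by
      rw [IccExtend_of_mem hL.le _ (Ioo_subset_Icc_self hr),
        IccExtend_of_mem hL.le _ (Ioo_subset_Icc_self hr)]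
      simp only [hqc, ContinuousMap.mul_apply, ContinuousMap.add_apply,
        ContinuousMap.smul_apply, ContinuousMap.one_apply, smul_eq_mul, mul_one]
      rfl
    rw [hqh] at h2
    refine ⟨((hasDerivAt_pow (l + 1) r).mul h1).congr_deriv (by push_cast; simp), ?_⟩
    refine ((((hasDerivAt_pow l r).const_mul ((l : ℝ) + 1)).mul h1).add
      ((hasDerivAt_pow (l + 1) r).mul h2)).congr_deriv ?_
    rcases l with - | l
    · simp only [hd]
      push_cast
      field_simp
      ring
    · simp only [Nat.add_sub_cancel, hd]
      push_cast
      field_simp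
      ring
  · have hc : Continuous (IccExtend hL.le (h z)) := (h z).continuous.Icc_extend'
    have h0 : IccExtend hL.le (h z) 0 = 1 := by
      rw [hheq' z 0, IccExtend_of_mem hL.le _ ⟨le_rfl, hL.le⟩, primitiveCLM_apply]
      simp
    have := hc.tendsto 0
    rw [h0] at this
    refine (this.mono_left nhdsWithin_le_nhds).congr' ?_
    filter_upwards [self_mem_nhdsWithin] with r hr
    have hr0 : r ≠ 0 := ne_of_gt hr
    field_simp
  · exact (continuous_pow _).mul (h z).continuous.Icc_extend'
  · exact continuous_const.mul (hext h hhcont r)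
  · exact (continuous_const.mul (hext h hhcont r)).add (continuous_const.mul (hext d hdcont r))

end Regular

/-! ### The Macdonald function of imaginary order -/

theorem sq_div_four_le_cosh (s : ℝ) : s ^ 2 / 4 ≤ Real.cosh s ∧ |s| ≤ Real.cosh s := by
  have h := Real.quadratic_le_exp_of_nonneg (abs_nonneg s)
  have h2 : Real.exp |s| / 2 ≤ Real.cosh s := by
    rw [← Real.cosh_abs, Real.cosh_eq]
    have := Real.exp_pos (-|s|)
    linarith
  rw [sq_abs] at h
  refine ⟨by linarith [abs_nonneg s], ?_⟩
  nlinarith [sq_nonneg (|s| - 1), sq_abs s]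

theorem abs_sinh_le_cosh (s : ℝ) : |Real.sinh s| ≤ Real.cosh s := by
  refine abs_le.2 ⟨?_, (Real.sinh_lt_cosh s).le⟩
  have := Real.sinh_lt_cosh (-s)
  rw [Real.sinh_neg, Real.cosh_neg] at this
  linarith

theorem sq_le_mul_sinh (s : ℝ) : s ^ 2 ≤ s * Real.sinh s := by
  rcases le_total 0 s with h | h
  · have := Real.self_le_sinh_iff.2 h
    nlinarith
  · have := Real.sinh_le_self_iff.2 h
    nlinarith

theorem integrable_exp_neg_mul_cosh {a : ℝ} (ha : 0 < a) :
    Integrable fun s : ℝ => Real.exp (-(a * Real.cosh s)) := by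
  refine (integrable_exp_neg_mul_sq (b := a / 4) (by positivity)).mono'
    (Continuous.aestronglyMeasurable (by fun_prop)) (ae_of_all _ fun s => ?_)
  rw [Real.norm_eq_abs, abs_of_pos (Real.exp_pos _), Real.exp_le_exp]
  have := mul_le_mul_of_nonneg_left (sq_div_four_le_cosh s).1 ha.le
  linarith

/-- Half of the exponential absorbs the polynomial: 19 = 1 + 2 + 16, from 1 ≤ e^(y/2), y ≤ 2e^(y/2)
and y² ≤ 16e^(y/2). -/
theorem mul_exp_neg_le {y : ℝ} (hy : 0 ≤ y) :
    (1 + y + y ^ 2) * Real.exp (-y) ≤ 19 * Real.exp (-(y / 2)) := by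
  have h1 : y / 4 ≤ Real.exp (y / 4) := by linarith [Real.add_one_le_exp (y / 4)]
  have h2 : Real.exp (y / 2) = Real.exp (y / 4) * Real.exp (y / 4) := by
    rw [← Real.exp_add]; ring_nf
  have h3 : y / 2 + 1 ≤ Real.exp (y / 2) := Real.add_one_le_exp _
  have h4 : 1 + y + y ^ 2 ≤ 19 * Real.exp (y / 2) := by
    have : (y / 4) * (y / 4) ≤ Real.exp (y / 4) * Real.exp (y / 4) := by gcongr
    nlinarith
  calc (1 + y + y ^ 2) * Real.exp (-y) ≤ 19 * Real.exp (y / 2) * Real.exp (-y) := by gcongr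
    _ = 19 * Real.exp (-(y / 2)) := by rw [mul_assoc, ← Real.exp_add]; ring_nf

/-- Functions bounded by `(1 + y + y²) exp (-y)` with `y = exp t cosh s` are integrable in `s`. -/
theorem integrable_of_le_mul_exp {t : ℝ} {F : ℝ → ℝ} (hF : Continuous F)
    (C : ℝ) (h : ∀ s, |F s| ≤ C * ((1 + Real.exp t * Real.cosh s + (Real.exp t * Real.cosh s) ^ 2) *
      Real.exp (-(Real.exp t * Real.cosh s)))) : Integrable F := by
  have ht := Real.exp_pos t
  refine (((integrable_exp_neg_mul_cosh (half_pos ht)).const_mul 19).const_mul |C|).mono'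
    hF.aestronglyMeasurable (ae_of_all _ fun s => ?_)
  have hy : 0 ≤ Real.exp t * Real.cosh s := by have := Real.cosh_pos s; positivity
  refine (h s).trans ?_
  have := mul_exp_neg_le hy
  rw [mul_div_right_comm] at this
  exact mul_le_mul (le_abs_self C) this (by positivity) (abs_nonneg _)

/-- The Macdonald function `2 K_{iν}` in the variable `t = log x`. -/
def macdonald (ν t : ℝ) : ℝ :=
  ∫ s : ℝ, Real.exp (-(Real.exp t * Real.cosh s)) * Real.cos (ν * s)

def macdonaldDeriv (ν t : ℝ) : ℝ :=
  ∫ s : ℝ, -(Real.exp t * Real.cosh s) * Real.exp (-(Real.exp t * Real.cosh s)) * Real.cos (ν * s)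

/-- Differentiation under the integral sign. -/
theorem hasDerivAt_integral_of_le {F F' : ℝ → ℝ → ℝ} (hF : ∀ t, Continuous (F t))
    (hF' : ∀ t, Continuous (F' t)) (hd : ∀ t s, HasDerivAt (fun t => F t s) (F' t s) t)
    (hb : ∀ t s, |F t s| ≤ (1 + Real.exp t * Real.cosh s + (Real.exp t * Real.cosh s) ^ 2) *
      Real.exp (-(Real.exp t * Real.cosh s)))
    (hb' : ∀ t s, |F' t s| ≤ (1 + Real.exp t * Real.cosh s + (Real.exp t * Real.cosh s) ^ 2) *
      Real.exp (-(Real.exp t * Real.cosh s))) (t : ℝ) :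
    HasDerivAt (fun t => ∫ s, F t s) (∫ s, F' t s) t := by
  -- The majorant decreases in t, so its value at t - 1 dominates on the whole neighbourhood (t - 1,
  -- ∞).
  refine (hasDerivAt_integral_of_dominated_loc_of_deriv_le (μ := volume) (s := Ioi (t - 1))
    (bound := fun s => 19 * Real.exp (-(Real.exp (t - 1) / 2 * Real.cosh s)))
    (isOpen_Ioi.mem_nhds (by simp)) (Eventually.of_forall fun t => (hF t).aestronglyMeasurable)
    (integrable_of_le_mul_exp (hF t) 1 fun s => by rw [one_mul]; exact hb t s)
    (hF' t).aestronglyMeasurable (ae_of_all _ fun s x hx => ?_)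
    ((integrable_exp_neg_mul_cosh (by positivity)).const_mul 19)
    (ae_of_all _ fun s x _ => hd x s)).2
  have hc := Real.cosh_pos s
  refine (hb' x s).trans ((mul_exp_neg_le (by positivity)).trans ?_)
  have hx' : t - 1 ≤ x := le_of_lt hx
  rw [mul_div_right_comm]
  gcongr

theorem hasDerivAt_exp_neg_exp_mul (c t : ℝ) : HasDerivAt (fun t => Real.exp (-(Real.exp t * c)))
    (-(Real.exp t * c) * Real.exp (-(Real.exp t * c))) t :=
  (((Real.hasDerivAt_exp t).mul_const c).neg.exp).congr_deriv (by
    simp only [Pi.neg_apply]; ring)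

theorem abs_mul_cos_le (a x : ℝ) : |a * Real.cos x| ≤ |a| := by
  rw [abs_mul]
  exact mul_le_of_le_one_right (abs_nonneg _) (Real.abs_cos_le_one x)

theorem hasDerivAt_macdonald (ν t : ℝ) : HasDerivAt (macdonald ν) (macdonaldDeriv ν t) t := by
  refine hasDerivAt_integral_of_le
    (F := fun t s => Real.exp (-(Real.exp t * Real.cosh s)) * Real.cos (ν * s))
    (F' := fun t s => -(Real.exp t * Real.cosh s) * Real.exp (-(Real.exp t * Real.cosh s)) *
      Real.cos (ν * s)) (fun t => by fun_prop) (fun t => by fun_prop)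
    (fun t s => (hasDerivAt_exp_neg_exp_mul _ t).mul_const _) (fun t s => ?_) (fun t s => ?_) t
  all_goals
    have hc := Real.cosh_pos s
    have hy : 0 < Real.exp t * Real.cosh s := by positivity
    refine (abs_mul_cos_le _ _).trans ?_
  · rw [abs_of_pos (Real.exp_pos _)]
    exact le_mul_of_one_le_left (Real.exp_pos _).le (by nlinarith)
  · rw [abs_mul, abs_of_pos (Real.exp_pos _), abs_neg, abs_of_pos hy]
    gcongr
    nlinarith

/-- The modified Bessel equation of imaginary order. -/
theorem hasDerivAt_macdonaldDeriv (ν t : ℝ) :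
    HasDerivAt (macdonaldDeriv ν) ((Real.exp t ^ 2 - ν ^ 2) * macdonald ν t) t := by
  have h1 : HasDerivAt (macdonaldDeriv ν) (∫ s : ℝ,
      ((Real.exp t * Real.cosh s) ^ 2 - Real.exp t * Real.cosh s) *
        Real.exp (-(Real.exp t * Real.cosh s)) * Real.cos (ν * s)) t := by
    refine hasDerivAt_integral_of_le
      (F := fun t s => -(Real.exp t * Real.cosh s) * Real.exp (-(Real.exp t * Real.cosh s)) *
        Real.cos (ν * s))
      (F' := fun t s => ((Real.exp t * Real.cosh s) ^ 2 - Real.exp t * Real.cosh s) *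
        Real.exp (-(Real.exp t * Real.cosh s)) * Real.cos (ν * s)) (fun t => by fun_prop)
      (fun t => by fun_prop) (fun t s => ?_) (fun t s => ?_) (fun t s => ?_) t
    · refine ((((Real.hasDerivAt_exp t).mul_const (Real.cosh s)).neg.mul
        (hasDerivAt_exp_neg_exp_mul (Real.cosh s) t)).mul_const _).congr_deriv ?_
      simp only [Pi.neg_apply]
      ring
    all_goals
      have hc := Real.cosh_pos s
      have hy : 0 < Real.exp t * Real.cosh s := by positivity
      refine (abs_mul_cos_le _ _).trans ?_
      rw [abs_mul, abs_of_pos (Real.exp_pos (-_))]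
      gcongr
      refine abs_le.2 ⟨by nlinarith, by nlinarith⟩
  refine h1.congr_deriv ?_
  set x := Real.exp t with hx
  have hx0 : 0 < x := Real.exp_pos t
  -- G is a primitive in s of the difference of the integrands of w'' and (x² - ν²)w. It is
  -- integrable with integrable derivative, so that derivative integrates to 0.
  set G : ℝ → ℝ := fun s => -(x * Real.sinh s) * Real.exp (-(x * Real.cosh s)) * Real.cos (ν * s)
    + ν * (Real.exp (-(x * Real.cosh s)) * Real.sin (ν * s)) with hG
  have hI0 : Integrable fun s : ℝ => Real.exp (-(x * Real.cosh s)) * Real.cos (ν * s) := by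
    refine integrable_of_le_mul_exp (t := t) (by fun_prop) 1 fun s => ?_
    have hc := Real.cosh_pos s
    refine (abs_mul_cos_le _ _).trans ?_
    rw [abs_of_pos (Real.exp_pos _), one_mul, ← hx]
    exact le_mul_of_one_le_left (Real.exp_pos _).le (by nlinarith [mul_pos hx0 hc])
  have hI2 : Integrable fun s : ℝ => ((x * Real.cosh s) ^ 2 - x * Real.cosh s) *
      Real.exp (-(x * Real.cosh s)) * Real.cos (ν * s) := by
    refine integrable_of_le_mul_exp (t := t) (by fun_prop) 1 fun s => ?_
    have hc := Real.cosh_pos s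
    have hy := mul_pos hx0 hc
    refine (abs_mul_cos_le _ _).trans ?_
    rw [abs_mul, abs_of_pos (Real.exp_pos (-_)), one_mul, ← hx]
    gcongr
    refine abs_le.2 ⟨by nlinarith, by nlinarith⟩
  have hGI : Integrable G := by
    refine integrable_of_le_mul_exp (t := t) (by fun_prop) (1 + |ν|) fun s => ?_
    have hc := Real.cosh_pos s
    have hy := mul_pos hx0 hc
    have hs := abs_sinh_le_cosh s
    rw [← hx]
    refine (abs_add_le _ _).trans ?_
    rw [add_mul, one_mul]
    refine add_le_add ?_ ?_
    · refine (abs_mul_cos_le _ _).trans ?_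
      rw [abs_mul, abs_of_pos (Real.exp_pos (-_)), abs_neg, abs_mul, abs_of_pos hx0]
      gcongr
      nlinarith [mul_le_mul_of_nonneg_left hs hx0.le]
    · rw [abs_mul, abs_mul, abs_of_pos (Real.exp_pos _)]
      refine mul_le_mul_of_nonneg_left ?_ (abs_nonneg ν)
      rw [mul_comm]
      refine mul_le_mul_of_nonneg_right ((Real.abs_sin_le_one _).trans ?_) (Real.exp_pos _).le
      nlinarith
  have hd : ∀ s, HasDerivAt G (((x * Real.cosh s) ^ 2 - x * Real.cosh s) *
      Real.exp (-(x * Real.cosh s)) * Real.cos (ν * s) -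
      (x ^ 2 - ν ^ 2) * (Real.exp (-(x * Real.cosh s)) * Real.cos (ν * s))) s := by
    intro s
    have hν : HasDerivAt (fun s => ν * s) ν s := by simpa using (hasDerivAt_id s).const_mul ν
    have he := ((Real.hasDerivAt_cosh s).const_mul x).neg.exp
    have h := (((((Real.hasDerivAt_sinh s).const_mul x).neg).mul he).mul hν.cos).add
      ((he.mul hν.sin).const_mul ν)
    refine h.congr_deriv ?_
    simp only [Pi.neg_apply, Pi.mul_apply]
    have hcs := Real.cosh_sq s
    linear_combination (x ^ 2 * Real.exp (-(x * Real.cosh s)) * Real.cos (ν * s)) * (-hcs)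
  have h0 := integral_eq_zero_of_hasDerivAt_of_integrable hd (hI2.sub (hI0.const_mul _)) hGI
  rw [integral_sub hI2 (hI0.const_mul _), integral_const_mul] at h0
  rw [macdonald]
  linarith

/-- Use cos(νs) ≥ 1 - ν²s²/2 and ν²s² ≤ x s sinh s. Integration by parts shows ∫ x s sinh s e^(-x
cosh s) = ∫ e^(-x cosh s), so at least half of the latter integral remains. -/
theorem macdonald_pos {ν t : ℝ} (ht : ν ^ 2 ≤ Real.exp t) : 0 < macdonald ν t := by
  set x := Real.exp t with hx
  have hx0 : 0 < x := Real.exp_pos t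
  have hA := integrable_exp_neg_mul_cosh hx0
  have hB : Integrable fun s : ℝ => x * (s * Real.sinh s) * Real.exp (-(x * Real.cosh s)) := by
    refine integrable_of_le_mul_exp (t := t) (by fun_prop) (1 / x) fun s => ?_
    have hc := Real.cosh_pos s
    have hy := mul_pos hx0 hc
    rw [← hx, abs_mul, abs_of_pos (Real.exp_pos _), abs_mul, abs_of_pos hx0, abs_mul,
      ← mul_assoc (1 / x)]
    refine mul_le_mul_of_nonneg_right ?_ (Real.exp_pos _).le
    calc x * (|s| * |Real.sinh s|) ≤ x * (Real.cosh s * Real.cosh s) := by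
          gcongr
          · exact (sq_div_four_le_cosh s).2
          · exact abs_sinh_le_cosh s
      _ = 1 / x * (x * Real.cosh s) ^ 2 := by field_simp
      _ ≤ _ := mul_le_mul_of_nonneg_left (by linarith) (by positivity)
  have hC : Integrable fun s : ℝ => s * Real.exp (-(x * Real.cosh s)) := by
    refine integrable_of_le_mul_exp (t := t) (by fun_prop) (1 / x) fun s => ?_
    have hc := Real.cosh_pos s
    have hy := mul_pos hx0 hc
    rw [← hx, abs_mul, abs_of_pos (Real.exp_pos _), ← mul_assoc (1 / x)]
    refine mul_le_mul_of_nonneg_right ?_ (Real.exp_pos _).le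
    calc |s| ≤ Real.cosh s := (sq_div_four_le_cosh s).2
      _ = 1 / x * (x * Real.cosh s) := by field_simp
      _ ≤ _ := mul_le_mul_of_nonneg_left (by nlinarith) (by positivity)
  have hd : ∀ s : ℝ, HasDerivAt (fun s : ℝ => s * Real.exp (-(x * Real.cosh s)))
      (Real.exp (-(x * Real.cosh s)) - x * (s * Real.sinh s) * Real.exp (-(x * Real.cosh s))) s := by
    intro s
    refine ((hasDerivAt_id s).mul ((Real.hasDerivAt_cosh s).const_mul x).neg.exp).congr_deriv ?_
    simp only [Pi.neg_apply, id]
    ring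
  have hAB : Integrable fun s : ℝ =>
      Real.exp (-(x * Real.cosh s)) - x * (s * Real.sinh s) * Real.exp (-(x * Real.cosh s)) :=
    hA.sub hB
  have h0 := integral_eq_zero_of_hasDerivAt_of_integrable hd hAB hC
  have hpos : 0 < ∫ s : ℝ, Real.exp (-(x * Real.cosh s)) := integral_exp_pos hA
  have hI : Integrable fun s : ℝ => Real.exp (-(x * Real.cosh s)) * Real.cos (ν * s) := by
    refine hA.mono' (Continuous.aestronglyMeasurable (by fun_prop)) (ae_of_all _ fun s => ?_)
    exact (abs_mul_cos_le _ _).trans_eq (abs_of_pos (Real.exp_pos _))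
  have hle : ∫ s : ℝ, (1 / 2 * Real.exp (-(x * Real.cosh s)) + 1 / 2 * (Real.exp (-(x * Real.cosh s))
      - x * (s * Real.sinh s) * Real.exp (-(x * Real.cosh s)))) ≤ macdonald ν t := by
    refine integral_mono ((hA.const_mul _).add (hAB.const_mul _)) hI fun s => ?_
    have h1 := Real.one_sub_sq_div_two_le_cos (x := ν * s)
    have h2 : (ν * s) ^ 2 ≤ x * (s * Real.sinh s) := by
      rw [mul_pow]
      exact mul_le_mul ht (sq_le_mul_sinh s) (sq_nonneg s) hx0.le
    have h3 : 1 - x * (s * Real.sinh s) / 2 ≤ Real.cos (ν * s) := by linarith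
    have := mul_le_mul_of_nonneg_left h3 (Real.exp_pos (-(x * Real.cosh s))).le
    simp only
    linarith
  rw [integral_add (hA.const_mul _) (hAB.const_mul _), integral_const_mul,
    integral_const_mul, h0] at hle
  linarith

/-- As cosh s ≥ 1, x cosh s ≥ (x - a) + a cosh s for x ≥ a; the factor e⁻ˣ comes out. -/
theorem abs_macdonald_le (ν : ℝ) {a : ℝ} (ha : 0 < a) :
    ∃ C, ∀ t, a ≤ Real.exp t → |macdonald ν t| ≤ C * Real.exp (-Real.exp t) := by
  have hA := integrable_exp_neg_mul_cosh ha
  refine ⟨Real.exp a * ∫ s : ℝ, Real.exp (-(a * Real.cosh s)), fun t ht => ?_⟩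
  have hle : ∀ s : ℝ, ‖Real.exp (-(Real.exp t * Real.cosh s)) * Real.cos (ν * s)‖ ≤
      Real.exp (-(Real.exp t - a)) * Real.exp (-(a * Real.cosh s)) := by
    intro s
    refine (abs_mul_cos_le _ _).trans ?_
    rw [abs_of_pos (Real.exp_pos _), ← Real.exp_add, Real.exp_le_exp]
    nlinarith [Real.one_le_cosh s]
  have h := norm_integral_le_of_norm_le (hA.const_mul _) (ae_of_all _ hle)
  rw [integral_const_mul] at h
  refine h.trans_eq ?_
  rw [neg_sub, sub_eq_add_neg, Real.exp_add]
  ring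

/-! ### Oscillation of the Macdonald function at minus infinity -/

section Oscillation

variable {ν : ℝ}

/-- The energy `w'² + ν² w²` of the Macdonald function. -/
def macdonaldEnergy (ν t : ℝ) : ℝ := macdonaldDeriv ν t ^ 2 + ν ^ 2 * macdonald ν t ^ 2

theorem hasDerivAt_exp_sq (c t : ℝ) :
    HasDerivAt (fun t => c * Real.exp t ^ 2) (2 * c * Real.exp t ^ 2) t :=
  (((Real.hasDerivAt_exp t).pow 2).const_mul c).congr_deriv (by push_cast; ring)

theorem hasDerivAt_exp_mul_macdonaldEnergy (ν c t : ℝ) :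
    HasDerivAt (fun t => Real.exp (c * Real.exp t ^ 2) * macdonaldEnergy ν t)
      (2 * Real.exp (c * Real.exp t ^ 2) * Real.exp t ^ 2 *
        (c * macdonaldEnergy ν t + macdonald ν t * macdonaldDeriv ν t)) t := by
  refine ((hasDerivAt_exp_sq c t).exp.mul (((hasDerivAt_macdonaldDeriv ν t).pow 2).add
    (((hasDerivAt_macdonald ν t).pow 2).const_mul (ν ^ 2)))).congr_deriv ?_
  simp only [Pi.add_apply, Pi.pow_apply, macdonaldEnergy]
  push_cast
  ring

theorem abs_macdonald_mul_deriv_le (hν : 0 < ν) (t : ℝ) :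
    |macdonald ν t * macdonaldDeriv ν t| ≤ 1 / (2 * ν) * macdonaldEnergy ν t := by
  rw [one_div, ← div_eq_inv_mul, le_div_iff₀ (by positivity), macdonaldEnergy, abs_mul,
    ← sq_abs (macdonaldDeriv ν t), ← sq_abs (macdonald ν t)]
  nlinarith [sq_nonneg (|macdonaldDeriv ν t| - ν * |macdonald ν t|)]

/-- The energy has derivative 2e^(2t)ww', at most e^(2t)/ν times the energy in absolute value. The
exponent e^(2t)/(2ν) grows at exactly that rate and tends to 0 at -∞. -/
theorem monotone_macdonaldEnergy (hν : 0 < ν) :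
    Monotone fun t => Real.exp (1 / (2 * ν) * Real.exp t ^ 2) * macdonaldEnergy ν t := by
  refine monotone_of_hasDerivAt_nonneg (fun t => hasDerivAt_exp_mul_macdonaldEnergy ν _ t)
    fun t => ?_
  have := (abs_le.1 (abs_macdonald_mul_deriv_le hν t)).1
  exact mul_nonneg (by positivity) (by linarith)

theorem antitone_macdonaldEnergy (hν : 0 < ν) :
    Antitone fun t => Real.exp (-(1 / (2 * ν)) * Real.exp t ^ 2) * macdonaldEnergy ν t := by
  refine antitone_of_hasDerivAt_nonpos (fun t => hasDerivAt_exp_mul_macdonaldEnergy ν _ t)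
    fun t => ?_
  have := (abs_le.1 (abs_macdonald_mul_deriv_le hν t)).2
  exact mul_nonpos_of_nonneg_of_nonpos (by positivity) (by linarith)

/-- The function is positive far to the right, and the antitone weighted energy carries positivity
back to every t. This rules out a vanishing amplitude at -∞. -/
theorem macdonaldEnergy_pos (hν : 0 < ν) (t : ℝ) : 0 < macdonaldEnergy ν t := by
  set T := max t (Real.log (ν ^ 2)) with hT
  have h1 : 0 < macdonald ν T := by
    refine macdonald_pos ?_
    rw [← Real.exp_log (show 0 < ν ^ 2 by positivity)]
    exact Real.exp_le_exp.2 (le_max_right _ _)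
  have h2 : 0 < macdonaldEnergy ν T :=
    add_pos_of_nonneg_of_pos (sq_nonneg _) (by positivity)
  have h3 := antitone_macdonaldEnergy hν (le_max_left t (Real.log (ν ^ 2)))
  exact pos_of_mul_pos_right ((mul_pos (Real.exp_pos _) h2).trans_le h3) (Real.exp_pos _).le

theorem exists_macdonaldEnergy_bounds (hν : 0 < ν) :
    ∃ A B, 0 < A ∧ ∀ t ≤ 0, A ≤ macdonaldEnergy ν t ∧ macdonaldEnergy ν t ≤ B := by
  refine ⟨_, _, mul_pos (Real.exp_pos (-(1 / (2 * ν)) * Real.exp 0 ^ 2))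
    (macdonaldEnergy_pos hν 0), fun t ht => ⟨(antitone_macdonaldEnergy hν ht).trans ?_,
    le_trans ?_ (monotone_macdonaldEnergy hν ht)⟩⟩
  · refine mul_le_of_le_one_left (macdonaldEnergy_pos hν t).le (Real.exp_le_one_iff.2 ?_)
    rw [neg_mul]
    exact neg_nonpos.2 (by positivity)
  · exact le_mul_of_one_le_left (macdonaldEnergy_pos hν t).le (Real.one_le_exp (by positivity))

theorem exists_limit_of_hasDerivAt_exp {f b : ℝ → ℝ} {C : ℝ} (hb : Continuous b)
    (hbC : ∀ t ≤ 0, |b t| ≤ C)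
    (hf : ∀ t, HasDerivAt f (Real.exp t ^ 2 * b t) t) : ∃ A, Tendsto f atBot (𝓝 A) := by
  have hi : IntegrableOn (fun t => Real.exp t ^ 2 * b t) (Iic 0) := by
    refine ((integrableOn_exp_Iic 0).mul_const C).mono'
      (Continuous.aestronglyMeasurable (by fun_prop)) ?_
    filter_upwards [ae_restrict_mem measurableSet_Iic] with t ht
    have h1 : Real.exp t ≤ 1 := Real.exp_le_one_iff.2 ht
    have h2 := Real.exp_pos t
    rw [Real.norm_eq_abs, abs_mul, abs_of_pos (by positivity)]
    exact mul_le_mul (by nlinarith) (hbC t ht) (abs_nonneg _) h2.le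
  exact ⟨_, tendsto_limUnder_of_hasDerivAt_of_integrableOn_Iic (fun t _ => hf t) hi⟩

/-- As `t → -∞` the Macdonald function is asymptotic to a nonzero solution of `w'' = -ν² w`. -/
theorem exists_macdonald_asymptotics (hν : 0 < ν) :
    ∃ (P S : ℝ → ℝ) (P₀ S₀ : ℝ), Tendsto P atBot (𝓝 P₀) ∧ Tendsto S atBot (𝓝 S₀) ∧
      0 < P₀ ^ 2 + S₀ ^ 2 ∧
      (∀ t, ν * macdonald ν t = P t * Real.sin (ν * t) + S t * Real.cos (ν * t)) ∧
      ∀ t, macdonaldDeriv ν t = P t * Real.cos (ν * t) - S t * Real.sin (ν * t) := by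
  obtain ⟨A, B, hA, hAB⟩ := exists_macdonaldEnergy_bounds hν
  have hw : Continuous (macdonald ν) :=
    continuous_iff_continuousAt.2 fun t => (hasDerivAt_macdonald ν t).continuousAt
  have hwb : ∀ t ≤ 0, |macdonald ν t| ≤ √(B / ν ^ 2) := by
    intro t ht
    refine Real.abs_le_sqrt ?_
    rw [le_div_iff₀ (by positivity)]
    have := (hAB t ht).2
    rw [macdonaldEnergy] at this
    nlinarith [sq_nonneg (macdonaldDeriv ν t)]
  have hν' : ∀ t, HasDerivAt (fun s => ν * s) ν t := fun t => by
    simpa using (hasDerivAt_id t).const_mul ν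
  -- Variation of constants: rotating (w', νw) by the phase νt gives coordinates P, S with
  -- derivatives O(e^(2t)), hence convergent at -∞. P² + S² is the energy, which is bounded below.
  obtain ⟨P₀, hP₀⟩ := exists_limit_of_hasDerivAt_exp
    (f := fun t => macdonaldDeriv ν t * Real.cos (ν * t) + ν * macdonald ν t * Real.sin (ν * t))
    (b := fun t => macdonald ν t * Real.cos (ν * t)) (C := √(B / ν ^ 2)) (by fun_prop)
    (fun t ht => (abs_mul_cos_le _ _).trans (hwb t ht)) fun t => by
      refine (((hasDerivAt_macdonaldDeriv ν t).mul (hν' t).cos).add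
        (((hasDerivAt_macdonald ν t).const_mul ν).mul (hν' t).sin)).congr_deriv ?_
      ring
  obtain ⟨S₀, hS₀⟩ := exists_limit_of_hasDerivAt_exp
    (f := fun t => ν * macdonald ν t * Real.cos (ν * t) - macdonaldDeriv ν t * Real.sin (ν * t))
    (b := fun t => -(macdonald ν t * Real.sin (ν * t))) (C := √(B / ν ^ 2)) (by fun_prop)
    (fun t ht => by
      rw [abs_neg, abs_mul]
      exact (mul_le_of_le_one_right (abs_nonneg _) (Real.abs_sin_le_one _)).trans (hwb t ht))
    fun t => by
      refine ((((hasDerivAt_macdonald ν t).const_mul ν).mul (hν' t).cos).sub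
        ((hasDerivAt_macdonaldDeriv ν t).mul (hν' t).sin)).congr_deriv ?_
      ring
  refine ⟨_, _, P₀, S₀, hP₀, hS₀, ?_, fun t => ?_, fun t => ?_⟩
  · refine hA.trans_le (ge_of_tendsto ((hP₀.pow 2).add (hS₀.pow 2)) ?_)
    filter_upwards [eventually_le_atBot 0] with t ht
    refine (hAB t ht).1.trans_eq ?_
    have := Real.sin_sq_add_cos_sq (ν * t)
    rw [macdonaldEnergy]
    linear_combination (-(macdonaldDeriv ν t ^ 2) - ν ^ 2 * macdonald ν t ^ 2) * this
  · have := Real.sin_sq_add_cos_sq (ν * t)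
    linear_combination (-ν * macdonald ν t) * this
  · have := Real.sin_sq_add_cos_sq (ν * t)
    linear_combination (-macdonaldDeriv ν t) * this

/-- With θ the argument of β₀ + iα₀, the expression tends to √(α₀² + β₀²) along νt = θ - 2πn and to
its negative along νt = θ + π - 2πn. The intermediate value theorem gives a zero in between. -/
theorem exists_zero_of_tendsto_trig (hν : 0 < ν) {α β : ℝ → ℝ} (hα : Continuous α)
    (hβ : Continuous β) {α₀ β₀ : ℝ} (hα₀ : Tendsto α atBot (𝓝 α₀)) (hβ₀ : Tendsto β atBot (𝓝 β₀))
    (h0 : 0 < α₀ ^ 2 + β₀ ^ 2) (T : ℝ) :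
    ∃ t < T, α t * Real.sin (ν * t) + β t * Real.cos (ν * t) = 0 := by
  set F : ℝ → ℝ := fun t => α t * Real.sin (ν * t) + β t * Real.cos (ν * t) with hF
  set z : ℂ := ⟨β₀, α₀⟩ with hz
  set θ := Complex.arg z with hθ
  have hcos : ‖z‖ * Real.cos θ = β₀ := Complex.norm_mul_cos_arg z
  have hsin : ‖z‖ * Real.sin θ = α₀ := Complex.norm_mul_sin_arg z
  have hz0 : 0 < ‖z‖ := by
    rw [norm_pos_iff]
    intro h
    have h1 : β₀ = 0 := congrArg Complex.re h
    have h2 : α₀ = 0 := congrArg Complex.im h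
    rw [h1, h2] at h0
    norm_num at h0
  have hval : α₀ * Real.sin θ + β₀ * Real.cos θ = ‖z‖ := by
    rw [← hcos, ← hsin]
    linear_combination ‖z‖ * Real.sin_sq_add_cos_sq θ
  have htend : ∀ c : ℝ, Tendsto (fun n : ℕ => (c - n * (2 * Real.pi)) / ν) atTop atBot := by
    intro c
    have h1 : Tendsto (fun n : ℕ => (n : ℝ) * (2 * Real.pi)) atTop atTop :=
      tendsto_natCast_atTop_atTop.atTop_mul_const (by positivity)
    have h2 : Tendsto (fun n : ℕ => c - (n : ℝ) * (2 * Real.pi)) atTop atBot :=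
      tendsto_atBot_add_const_left _ c (tendsto_neg_atTop_atBot.comp h1)
    exact h2.atBot_div_const hν
  have hFc : ∀ c : ℝ, Tendsto (fun n : ℕ => F ((c - n * (2 * Real.pi)) / ν)) atTop
      (𝓝 (α₀ * Real.sin c + β₀ * Real.cos c)) := by
    intro c
    refine (((hα₀.comp (htend c)).mul_const (Real.sin c)).add
      ((hβ₀.comp (htend c)).mul_const (Real.cos c))).congr fun n => ?_
    simp only [hF, Function.comp_apply]
    rw [mul_div_cancel₀ _ hν.ne', Real.sin_sub_nat_mul_two_pi, Real.cos_sub_nat_mul_two_pi]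
  have hpos := (hFc θ).eventually_const_lt (show (0 : ℝ) < α₀ * Real.sin θ + β₀ * Real.cos θ by
    rw [hval]; exact hz0)
  have hneg := (hFc (θ + Real.pi)).eventually_lt_const (show
    α₀ * Real.sin (θ + Real.pi) + β₀ * Real.cos (θ + Real.pi) < 0 by
    rw [Real.sin_add_pi, Real.cos_add_pi]; linarith)
  obtain ⟨n, hp, hn, hT⟩ := (hpos.and (hneg.and
    ((htend (θ + Real.pi)).eventually_lt_atBot T))).exists
  have hle : (θ - n * (2 * Real.pi)) / ν ≤ (θ + Real.pi - n * (2 * Real.pi)) / ν := by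
    gcongr; linarith [Real.pi_pos]
  obtain ⟨t, ht, ht0⟩ := intermediate_value_Icc' hle
    (Continuous.continuousOn (by fun_prop : Continuous F)) ⟨hn.le, hp.le⟩
  exact ⟨t, ht.2.trans_lt hT, ht0⟩

/-- `a w - b w'` has zeros near `-∞` if `(a, b)` has a nonzero limit there. -/
theorem exists_zero_macdonald_comb (hν : 0 < ν) {a b : ℝ → ℝ} (ha : Continuous a)
    (hb : Continuous b) {a₀ b₀ : ℝ} (ha₀ : Tendsto a atBot (𝓝 a₀)) (hb₀ : Tendsto b atBot (𝓝 b₀))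
    (h0 : a₀ ≠ 0 ∨ b₀ ≠ 0) (T : ℝ) :
    ∃ t < T, a t * macdonald ν t - b t * macdonaldDeriv ν t = 0 := by
  obtain ⟨P, S, P₀, S₀, hP, hS, hpos, hw, hw'⟩ := exists_macdonald_asymptotics hν
  have hPe : ∀ t, P t = macdonaldDeriv ν t * Real.cos (ν * t) +
      ν * macdonald ν t * Real.sin (ν * t) := fun t => by
    rw [hw, hw']
    linear_combination (-P t) * Real.sin_sq_add_cos_sq (ν * t)
  have hSe : ∀ t, S t = ν * macdonald ν t * Real.cos (ν * t) -
      macdonaldDeriv ν t * Real.sin (ν * t) := fun t => by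
    rw [hw, hw']
    linear_combination (-S t) * Real.sin_sq_add_cos_sq (ν * t)
  have hc : Continuous (macdonald ν) :=
    continuous_iff_continuousAt.2 fun t => (hasDerivAt_macdonald ν t).continuousAt
  have hc' : Continuous (macdonaldDeriv ν) :=
    continuous_iff_continuousAt.2 fun t => (hasDerivAt_macdonaldDeriv ν t).continuousAt
  have hPc : Continuous P := by rw [funext hPe]; fun_prop
  have hSc : Continuous S := by rw [funext hSe]; fun_prop
  have hab : 0 < a₀ ^ 2 + ν ^ 2 * b₀ ^ 2 := by
    rcases h0 with h | h
    · exact add_pos_of_pos_of_nonneg (by positivity) (by positivity)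
    · exact add_pos_of_nonneg_of_pos (by positivity) (by positivity)
  -- These are the sine and cosine coefficients of ν(aw - bw'). Their limits have sum of squares
  -- (a₀² + ν²b₀²)(P₀² + S₀²) > 0.
  obtain ⟨t, ht, ht0⟩ := exists_zero_of_tendsto_trig hν
    (α := fun t => a t * P t + ν * b t * S t) (β := fun t => a t * S t - ν * b t * P t)
    (by fun_prop) (by fun_prop)
    ((ha₀.mul hP).add ((hb₀.const_mul ν).mul hS)) ((ha₀.mul hS).sub ((hb₀.const_mul ν).mul hP))
    (by nlinarith [mul_pos hab hpos]) T
  refine ⟨t, ht, ?_⟩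
  have h : ν * (a t * macdonald ν t - b t * macdonaldDeriv ν t) = 0 := by
    rw [← ht0]
    linear_combination a t * hw t - ν * b t * hw' t
  exact (mul_eq_zero.1 h).resolve_left hν.ne'

end Oscillation

/-! ### Matching inner and outer solutions above the threshold -/

theorem hasDerivAt_ite_le {f₁ f₂ : ℝ → ℝ} {d R : ℝ} (h₁ : HasDerivAt f₁ d R)
    (h₂ : HasDerivAt f₂ d R) (h : f₁ R = f₂ R) :
    HasDerivAt (fun r => if r ≤ R then f₁ r else f₂ r) d R := by
  have e1 : HasDerivWithinAt (fun r => if r ≤ R then f₁ r else f₂ r) d (Iic R) R :=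
    h₁.hasDerivWithinAt.congr (fun r hr => if_pos hr) (if_pos le_rfl)
  have e2 : HasDerivWithinAt (fun r => if r ≤ R then f₁ r else f₂ r) d (Ici R) R := by
    refine h₂.hasDerivWithinAt.congr (fun r hr => ?_) ((if_pos le_rfl).trans h)
    rcases (show R ≤ r from hr).eq_or_lt with rfl | hlt
    · exact (if_pos le_rfl).trans h
    · exact if_neg (not_le.2 hlt)
  have := e1.union e2
  rwa [Iic_union_Ici, hasDerivWithinAt_univ] at this

/-- Matching values and first derivatives suffices, since both second derivatives at R are then p(R)
times the common value. -/
theorem IsSolution.glue {p u₁ u₁' u₂ u₂' : ℝ → ℝ} {R L : ℝ} (hRL : R < L) (hR : 0 < R)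
    (h₁ : IsSolution p u₁ u₁' (Ioo 0 L)) (h₂ : IsSolution p u₂ u₂' (Ici R)) (h : u₁ R = u₂ R)
    (h' : u₁' R = u₂' R) :
    IsSolution p (fun r => if r ≤ R then u₁ r else u₂ r)
      (fun r => if r ≤ R then u₁' r else u₂' r) (Ioi 0) := by
  intro r hr
  have hr0 : 0 < r := hr
  rcases lt_trichotomy r R with hlt | rfl | hlt
  · have hev : ∀ᶠ x in 𝓝 r, x ≤ R := (eventually_lt_nhds hlt).mono fun _ h => h.le
    obtain ⟨a, b⟩ := h₁ r ⟨hr0, hlt.trans hRL⟩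
    simp only [if_pos hlt.le]
    exact ⟨a.congr_of_eventuallyEq (hev.mono fun x hx => if_pos hx),
      b.congr_of_eventuallyEq (hev.mono fun x hx => if_pos hx)⟩
  · obtain ⟨a, b⟩ := h₁ r ⟨hr0, hRL⟩
    obtain ⟨a', b'⟩ := h₂ r self_mem_Ici
    simp only [le_refl, if_true]
    rw [← h'] at a'
    rw [← h] at b'
    exact ⟨hasDerivAt_ite_le a a' h, hasDerivAt_ite_le b b' h'⟩
  · have hev : ∀ᶠ x in 𝓝 r, ¬ x ≤ R := (eventually_gt_nhds hlt).mono fun _ h => not_le.2 h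
    obtain ⟨a, b⟩ := h₂ r hlt.le
    simp only [if_neg (not_le.2 hlt)]
    exact ⟨a.congr_of_eventuallyEq (hev.mono fun x hx => if_neg hx),
      b.congr_of_eventuallyEq (hev.mono fun x hx => if_neg hx)⟩

/-- The decaying solution `√r K_{iν}(e^σ r)` of the outer equation. -/
def outerSol (ν σ r : ℝ) : ℝ := √r * macdonald ν (Real.log r + σ)

def outerSolDeriv (ν σ r : ℝ) : ℝ :=
  (macdonald ν (Real.log r + σ) / 2 + macdonaldDeriv ν (Real.log r + σ)) / √r

theorem isSolution_outerSol (ν σ : ℝ) :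
    IsSolution (fun r => -(ν ^ 2 + 1 / 4) / r ^ 2 + Real.exp σ ^ 2) (outerSol ν σ)
      (outerSolDeriv ν σ) (Ioi 0) := by
  intro r hr
  have hr0 : 0 < r := hr
  have hs : 0 < √r := Real.sqrt_pos.2 hr0
  have hsq : √r ^ 2 = r := Real.sq_sqrt hr0.le
  have h1 := Real.hasDerivAt_sqrt hr0.ne'
  have hl : HasDerivAt (fun r => Real.log r + σ) r⁻¹ r :=
    (Real.hasDerivAt_log hr0.ne').add_const σ
  have hw := (hasDerivAt_macdonald ν (Real.log r + σ)).comp r hl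
  have hw' := (hasDerivAt_macdonaldDeriv ν (Real.log r + σ)).comp r hl
  have hexp : Real.exp (Real.log r + σ) = r * Real.exp σ := by
    rw [Real.exp_add, Real.exp_log hr0]
  rw [hexp] at hw'
  constructor
  · refine (h1.mul hw).congr_deriv ?_
    simp only [Function.comp_apply, outerSolDeriv]
    generalize macdonald ν (Real.log r + σ) = w
    generalize macdonaldDeriv ν (Real.log r + σ) = w'
    generalize hy : √r = y at *
    subst hsq
    field_simp
  · refine (((hw.div_const 2).add hw').div h1 hs.ne').congr_deriv ?_
    simp only [Function.comp_apply, outerSol, Pi.add_apply]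
    generalize macdonald ν (Real.log r + σ) = w
    generalize macdonaldDeriv ν (Real.log r + σ) = w'
    generalize hy : √r = y at *
    subst hsq
    field_simp
    ring

/-- The square of the Macdonald bound decays like e^(-2κr); one factor e^(-κr) absorbs the r coming
from √r². -/
theorem outerSol_isBigO (ν σ : ℝ) {R : ℝ} (hR : 0 < R) :
    (fun r => outerSol ν σ r ^ 2) =O[atTop] fun r => Real.exp (-Real.exp σ * r) := by
  have hκ := Real.exp_pos σ
  set κ := Real.exp σ with hκdef
  obtain ⟨C, hC⟩ := abs_macdonald_le ν (a := R * κ) (by positivity)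
  refine Asymptotics.IsBigO.of_bound (C ^ 2 / κ) ?_
  filter_upwards [eventually_ge_atTop R] with r hr
  have hr0 : 0 < r := hR.trans_le hr
  have hexp : Real.exp (Real.log r + σ) = r * κ := by rw [Real.exp_add, Real.exp_log hr0]
  have h1 := hC (Real.log r + σ) (by rw [hexp]; gcongr)
  rw [hexp] at h1
  rw [Real.norm_eq_abs, Real.norm_eq_abs, abs_of_nonneg (sq_nonneg _), abs_of_pos (Real.exp_pos _),
    outerSol, mul_pow, Real.sq_sqrt hr0.le, ← sq_abs (macdonald _ _)]
  have h2 : r * κ ≤ Real.exp (r * κ) := by linarith [Real.add_one_le_exp (r * κ)]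
  have h3 : Real.exp (-(r * κ)) = Real.exp (-κ * r) := by ring_nf
  have h4 : Real.exp (r * κ) * Real.exp (-(r * κ)) = 1 := by rw [← Real.exp_add]; simp
  calc r * |macdonald ν (Real.log r + σ)| ^ 2 ≤ r * (C * Real.exp (-(r * κ))) ^ 2 := by gcongr
    _ = C ^ 2 / κ * ((r * κ) * Real.exp (-(r * κ)) * Real.exp (-(r * κ))) := by
        field_simp
    _ ≤ C ^ 2 / κ * (Real.exp (r * κ) * Real.exp (-(r * κ)) * Real.exp (-(r * κ))) := by gcongr
    _ = _ := by rw [h4, one_mul, h3]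

theorem exists_smul_eq {a b c d : ℝ} (h : c ≠ 0 ∨ d ≠ 0) (hW : a * d = b * c) :
    ∃ k : ℝ, a = k * c ∧ b = k * d := by
  rcases h with h | h
  · refine ⟨a / c, by field_simp, ?_⟩
    field_simp; linarith
  · refine ⟨b / d, ?_, by field_simp⟩
    field_simp; linarith

/-- In the supercritical case there are infinitely many eigenvalues. -/
theorem infinite_eigenvalues {e c R : ℝ} {l : ℕ} {V : ℝ → ℝ} (he : 0 < e) (hR : 0 < R)
    (hV : ContinuousOn V (Ici 0)) (hout : ∀ r, R ≤ r → V r = -(c / r ^ 2))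
    (hsup : (l : ℝ) * (l + 1) + 1 / 4 < c / e) : {E | IsRadialEigenvalue e l V E}.Infinite := by
  set ν := √(c / e - (l * (l + 1) + 1 / 4)) with hνdef
  have hν : 0 < ν := Real.sqrt_pos.2 (by linarith)
  have hν2 : ν ^ 2 = c / e - (l * (l + 1) + 1 / 4) := Real.sq_sqrt (by linarith)
  -- The length R + 1 makes R an interior point, where the solution is differentiable from both
  -- sides.
  obtain ⟨φ, φ', hφ, hφ1, hφ0, hφc⟩ := exists_regular_solution (L := R + 1) (by linarith) l
    (q := fun r => V r / e) ((hV.mono Icc_subset_Ici_self).div_const e)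
  -- The parameter is t = log(κR), so at r = R the Macdonald function is evaluated at t itself. The
  -- energy is E = -e z with z = κ², and t → -∞ means E → 0 from below.
  set σ : ℝ → ℝ := fun t => t - Real.log R with hσ
  set z : ℝ → ℝ := fun t => Real.exp (σ t) ^ 2 with hz
  have hzc : Continuous z := by fun_prop
  have hz0 : Tendsto z atBot (𝓝 0) := by
    have h1 : Tendsto σ atBot atBot := tendsto_atBot_add_const_right _ (-Real.log R) tendsto_id
    simpa using (Real.tendsto_exp_atBot.comp h1).pow 2
  have hcoeff : ∀ t, (fun r => (l : ℝ) * (l + 1) / r ^ 2 + (V r / e + z t)) =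
      radialCoeff e l V (-(e * z t)) := fun t => by
    ext r
    rw [radialCoeff, sub_div, neg_div, mul_div_cancel_left₀ _ he.ne', sub_neg_eq_add]
  have hpc : ContinuousOn (fun r => (l : ℝ) * (l + 1) / r ^ 2 + (V r / e + 0)) (Ioi 0) := by
    have := continuousOn_radialCoeff e l (hV.mono Ioi_subset_Ici_self) 0
    refine this.congr fun r _ => ?_
    rw [radialCoeff, sub_zero, add_zero]
  have hdata := ((hφ 0).mono fun r (hr : r ∈ Ioc 0 R) =>
    (⟨hr.1, hr.2.trans_lt (by linarith)⟩ : r ∈ Ioo 0 (R + 1))).cauchyData_ne_zero hR hpc (hφ1 0)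
  have hzero := exists_zero_macdonald_comb hν (a := fun t => R * φ' (z t) R - φ (z t) R / 2)
    (b := fun t => φ (z t) R)
    ((continuous_const.mul ((hφc R).2.comp hzc)).sub (((hφc R).1.comp hzc).div_const 2))
    ((hφc R).1.comp hzc)
    (((((hφc R).2.tendsto 0).comp hz0).const_mul R).sub ((((hφc R).1.tendsto 0).comp hz0).div_const 2))
    (((hφc R).1.tendsto 0).comp hz0) (by
      by_contra! h
      obtain ⟨ha, hb⟩ := h
      rw [hb, zero_div, sub_zero] at ha
      rcases hdata with h1 | h1
      · exact h1 hb
      · exact h1 ((mul_eq_zero.1 ha).resolve_left hR.ne'))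
  -- Up to a nonzero factor, this expression is the Wronskian at R of the inner and outer solutions.
  set Z : Set ℝ := {t | (R * φ' (z t) R - φ (z t) R / 2) * macdonald ν t -
    φ (z t) R * macdonaldDeriv ν t = 0} with hZ
  have hZinf : Z.Infinite := by
    intro hfin
    obtain ⟨B, hB⟩ := hfin.bddBelow
    obtain ⟨t, ht, ht0⟩ := hzero B
    exact absurd (hB ht0) (not_le.2 ht)
  have hinj : InjOn (fun t => -(e * z t)) Z := by
    intro s _ t _ hst
    have h1 : z s = z t := mul_left_cancel₀ he.ne' (neg_injective hst)
    have h2 : Real.exp (σ s) = Real.exp (σ t) :=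
      (pow_left_inj₀ (Real.exp_pos _).le (Real.exp_pos _).le two_ne_zero).1 h1
    have h3 : s - Real.log R = t - Real.log R := Real.exp_injective h2
    linarith
  refine (hZinf.image hinj).mono ?_
  rintro _ ⟨t, ht, rfl⟩
  have hlog : Real.log R + σ t = t := by simp only [hσ]; ring
  have hsR : 0 < √R := Real.sqrt_pos.2 hR
  have hsq : √R ^ 2 = R := Real.sq_sqrt hR.le
  -- The outer Cauchy data at R cannot both vanish since the Macdonald energy is positive; the zero
  -- Wronskian then makes the inner data a multiple of them.
  obtain ⟨k, hk, hk'⟩ := exists_smul_eq (a := φ (z t) R) (b := φ' (z t) R)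
    (c := outerSol ν (σ t) R) (d := outerSolDeriv ν (σ t) R) (by
      by_contra! h
      obtain ⟨h1, h2⟩ := h
      rw [outerSol, hlog, mul_eq_zero] at h1
      have h3 := h1.resolve_left hsR.ne'
      rw [outerSolDeriv, hlog, h3, zero_div, zero_add, div_eq_zero_iff] at h2
      have h4 := h2.resolve_right hsR.ne'
      have := macdonaldEnergy_pos hν t
      rw [macdonaldEnergy, h3, h4] at this
      norm_num at this) (by
      rw [outerSol, outerSolDeriv, hlog]
      have ht' : (R * φ' (z t) R - φ (z t) R / 2) * macdonald ν t -
        φ (z t) R * macdonaldDeriv ν t = 0 := ht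
      field_simp
      rw [hsq]
      linarith)
  have hin := hφ (z t)
  rw [hcoeff t] at hin
  have hosol : IsSolution (radialCoeff e l V (-(e * z t))) (fun r => k * outerSol ν (σ t) r)
      (fun r => k * outerSolDeriv ν (σ t) r) (Ici R) := by
    intro r hr
    have hr0 : 0 < r := hR.trans_le hr
    have := ((isSolution_outerSol ν (σ t)).const_mul k) r hr0
    convert this using 3
    rw [radialCoeff_of_le hout _ hr, neg_div, mul_div_cancel_left₀ _ he.ne', hν2]
    simp only [hz]
    ring
  have hglue := hin.glue (by linarith) hR hosol hk hk'
  have hcont : ContinuousOn (fun r => if r ≤ R then φ (z t) r else k * outerSol ν (σ t) r)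
      (Ici 0) := by
    intro r hr
    rcases (show (0 : ℝ) ≤ r from hr).eq_or_lt with rfl | hr0
    · refine ContinuousAt.continuousWithinAt ((hφ0 (z t)).1.continuousAt.congr ?_)
      filter_upwards [eventually_lt_nhds hR] with x hx
      rw [if_pos hx.le]
    · exact (hglue r hr0).1.continuousAt.continuousWithinAt
  refine isRadialEigenvalue_of_isSolution he.ne' (hV.mono Ioi_subset_Ici_self) hglue ?_ ?_ ?_
  · rw [memLp_two_iff_integrable_sq
      ((hcont.mono Ioi_subset_Ici_self).aestronglyMeasurable measurableSet_Ioi)]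
    refine integrable_of_isBigO_exp_neg (Real.exp_pos (σ t)) (hcont.pow 2) ?_
    have hO := (outerSol_isBigO ν (σ t) hR).const_mul_left (k ^ 2)
    refine hO.congr' ?_ EventuallyEq.rfl
    filter_upwards [eventually_gt_atTop R] with r hr
    rw [if_neg (not_le.2 hr), mul_pow]
  · have := (hcont 0 self_mem_Ici).tendsto.mono_left (nhdsWithin_mono 0 Ioi_subset_Ici_self)
    simpa [hR.le, (hφ0 (z t)).2] using this
  · refine (hφ1 (z t)).congr' ?_
    filter_upwards [Ioc_mem_nhdsGT hR] with r hr
    rw [if_pos hr.2]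

end Efimov

end

theorem mainTheorem8 (l : ℕ) (hl : 1 ≤ l) (k : ℕ) (M m : ℝ) (hM : 0 < M) (hm : 0 < m) :
    {E : ℝ | Efimov.IsRadialEigenvalue (Efimov.epsSq M m) l (Efimov.potential k) E}.Infinite ↔
      Efimov.criticalMassRatio l < M / m := by
  have he := Efimov.epsSq_pos hM hm
  rw [Efimov.criticalMassRatio_lt_iff l hM hm]
  constructor
  · intro h
    by_contra! hn
    exact h (Efimov.finite_eigenvalues he (Efimov.rRoot_pos k) hl (Efimov.continuousOn_potential k)
      (fun r hr => Efimov.potential_of_le hr) hn)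
  · intro h
    exact Efimov.infinite_eigenvalues he (Efimov.rRoot_pos k) (Efimov.continuousOn_potential k)
      (fun r hr => Efimov.potential_of_le hr) h
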